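/- Let $\mathcal O\subset\mathbb R^3$ be a bounded open set whose boundary $M=\partial\mathcal O$ is a smooth surface that is diffeomorphic to $S^2$, is invariant under the rotations $R_s$ about the $x_3$-axis, and has positive Gauss curvature everywhere. Let $\nu$ be the outward unit normal of $M$, let $\chi(x)=e_3\cdot\nu(x)$, let $J:T_xM\to T_xM$, $Jv=\nu(x)\times v$, be the counterclockwise rotation by $90^\circ$, and let $X_3(x)=(-x_2,x_1,0)$ be the vector field on $M$ that generates the flow $R_s$. Let $\xi\in C^\infty(M)$ satisfy $J\nabla\xi=-X_3$. Let $\Omega\in\mathbb R$, let $I\subset\mathbb R$ be an interval, and let $u$ be a classical solution on $I$ of the Euler equation $$\frac{\partial u}{\partial t}+\nabla_u u=\Omega\,\chi(x)Ju-\nabla p,\qquad \operatorname{div}u=0,$$ that is, a time-dependent tangent vector field on $M$, of class $C^1$ on $I\times M$, which satisfies these equations with a pressure $p$ such that $p(t,\cdot)\in C^1(M)$ for each $t\in I$. Let $w(t)=\operatorname{rot}u(t)$ be the vorticity: $d\tilde u=w\,\alpha$, where $\tilde u$ is the $1$-form on $M$ dual to $u$ and $\alpha$ is the area form of $M$. Then,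 for each $t\in I$, the function $\xi\,w(t)$ is integrable on $M$ with respect to the surface measure $dS$, and $$\int_M \xi(x)\,w(t,x)\,dS(x)$$ is independent of $t\in I$. -/

import Mathlib

open Set Filter Topology MeasureTheory
open scoped ContDiff

noncomputable section

namespace SurfaceEuler

/-- Euclidean three-space. -/
abbrev E3 : Type := EuclideanSpace ℝ (Fin 3)

/-- The cross product on Euclidean three-space. -/
def cross (a b : E3) : E3 := WithLp.toLp 2 (crossProduct a.ofLp b.ofLp)

/-! ### Surfaces in three-space

Smoothness of functions on a surface `M` is expressed by `ContDiffOn ℝ n f M`.  For an embedded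
surface this is the usual notion: it says that `f` composed with every smooth local
parametrization is of class `C^n`. The derivative `fderivWithin ℝ f M x`, applied to a tangent
vector, is the directional derivative of `f` along that vector. -/

/-- `φ`, on the open set `U` of the plane, is a smooth local parametrization of `M`: an injective
immersion into `M` which is open as a map to `M`. -/
structure IsLocalParam (M : Set E3) (U : Set (ℝ × ℝ)) (φ : ℝ × ℝ → E3) : Prop where
  isOpen : IsOpen U
  contDiffOn : ContDiffOn ℝ ∞ φ U
  injOn : InjOn φ U
  immersion : ∀ y ∈ U, Function.Injective (fderiv ℝ φ y)
  mapsTo : MapsTo φ U M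
  openMap : ∀ V ⊆ U, IsOpen V → ∃ W : Set E3, IsOpen W ∧ φ '' V = W ∩ M

/-- `M` is a smooth embedded surface in three-space. -/
def IsSmoothSurface (M : Set E3) : Prop :=
  ∀ x ∈ M, ∃ (U : Set (ℝ × ℝ)) (φ : ℝ × ℝ → E3), IsLocalParam M U φ ∧ x ∈ φ '' U

/-- `M` is diffeomorphic to the unit sphere: there are smooth maps `M → S²` and `S² → M`, inverse
to each other (smooth maps on closed surfaces are restrictions of smooth maps of the space). -/
def DiffeoToSphere (M : Set E3) : Prop :=
  ∃ F G : E3 → E3, ContDiff ℝ ∞ F ∧ ContDiff ℝ ∞ G ∧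
    MapsTo F (Metric.sphere 0 1) M ∧ MapsTo G M (Metric.sphere 0 1) ∧
    LeftInvOn G F (Metric.sphere 0 1) ∧ LeftInvOn F G M

/-- The tangent space `T_x M`, as a linear subspace of three-space. -/
def tangentAt (M : Set E3) (x : E3) : Submodule ℝ E3 :=
  Submodule.span ℝ (tangentConeAt ℝ M x)

/-- `ν` is the unit normal field to `M = ∂O` pointing out of `O`. -/
structure IsOutwardUnitNormal (O M : Set E3) (ν : E3 → E3) : Prop where
  contDiffOn : ContDiffOn ℝ ∞ ν M
  norm_eq_one : ∀ x ∈ M, ‖ν x‖ = 1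
  normal : ∀ x ∈ M, ∀ v ∈ tangentAt M x, inner ℝ (ν x) v = 0
  outward : ∀ x ∈ M, ∀ᶠ s : ℝ in 𝓝[>] 0, x + s • ν x ∉ closure O ∧ x - s • ν x ∈ O

/-- The Levi-Civita covariant derivative `v ↦ ∇_v u` at `x`, of a vector field `u` on `M` (with
values in three-space): the tangential part of the directional derivative of `u`. -/
def covDeriv (M : Set E3) (u : E3 → E3) (x : E3) : tangentAt M x →ₗ[ℝ] tangentAt M x :=
  (tangentAt M x).orthogonalProjectionOnto.toLinearMap ∘ₗ
    (fderivWithin ℝ u M x).toLinearMap ∘ₗ (tangentAt M x).subtype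

/-- The divergence of a tangent vector field on `M`. -/
def surfDiv (M : Set E3) (u : E3 → E3) (x : E3) : ℝ :=
  LinearMap.trace ℝ (tangentAt M x) (covDeriv M u x)

/-- The convective term `∇_u u`: the tangential part of the derivative of `u` along itself. -/
def convect (M : Set E3) (u : E3 → E3) (x : E3) : E3 :=
  (tangentAt M x).starProjection (fderivWithin ℝ u M x (u x))

/-- The gradient on `M` of a scalar function on `M`. -/
def surfGrad (M : Set E3) (f : E3 → ℝ) (x : E3) : E3 :=
  (tangentAt M x).starProjection (gradientWithin f M x)

/-- The Gauss curvature of `M` at `x`: the determinant of the differential of the Gauss map `ν`,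
as an endomorphism of the tangent space. -/
def gaussCurvature (M : Set E3) (ν : E3 → E3) (x : E3) : ℝ :=
  LinearMap.det (covDeriv M ν x)

/-- `J`, the rotation of `T_x M` by `90°`, counterclockwise as seen from outside. -/
def rotJ (ν : E3 → E3) (x v : E3) : E3 := cross (ν x) v

/-- The function `χ = e₃ · ν`. -/
def chi (ν : E3 → E3) (x : E3) : ℝ := inner ℝ (EuclideanSpace.single 2 1 : E3) (ν x)

/-- `w = rot u`: if `ũ` is the 1-form on `M` dual to the tangent field `u` and `α` is the area form
`α(a, b) = ν · (a × b)`, then `dũ = w α`; here `dũ(a, b) = ⟨∇_a u, b⟩ - ⟨∇_b u, a⟩`. -/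
def IsVorticity (M : Set E3) (ν : E3 → E3) (u : E3 → E3) (w : E3 → ℝ) : Prop :=
  ∀ x ∈ M, ∀ a ∈ tangentAt M x, ∀ b ∈ tangentAt M x,
    inner ℝ (fderivWithin ℝ u M x a) b - inner ℝ (fderivWithin ℝ u M x b) a =
      w x * inner ℝ (ν x) (cross a b)

/-! ### Rotations about the third axis -/

/-- The rotation `R_s` about the `x₃`-axis. -/
def rotZ (s : ℝ) (x : E3) : E3 :=
  !₂[Real.cos s * x 0 - Real.sin s * x 1, Real.sin s * x 0 + Real.cos s * x 1, x 2]

/-- The vector field generating the flow `R_s`. -/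
def X3 (x : E3) : E3 := !₂[-x 1, x 0, 0]

theorem hasDerivAt_rotZ (s : ℝ) (x : E3) :
    HasDerivAt (fun s => rotZ s x) (X3 (rotZ s x)) s := by
  have h : HasDerivAt (fun s : ℝ => ![Real.cos s * x 0 - Real.sin s * x 1,
      Real.sin s * x 0 + Real.cos s * x 1, x 2])
      ![-(Real.sin s * x 0 + Real.cos s * x 1), Real.cos s * x 0 - Real.sin s * x 1, 0] s := by
    rw [hasDerivAt_pi]
    intro i
    fin_cases i
    · have := ((Real.hasDerivAt_cos s).mul_const (x 0)).sub
        ((Real.hasDerivAt_sin s).mul_const (x 1))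
      exact this.congr_deriv (by simp; ring)
    · have := ((Real.hasDerivAt_sin s).mul_const (x 0)).add
        ((Real.hasDerivAt_cos s).mul_const (x 1))
      exact this.congr_deriv (by simp; ring)
    · exact hasDerivAt_const s (x 2)
  exact (PiLp.hasFDerivAt_toLp 2 _).comp_hasDerivAt s h

/-! ### The Euler equation -/

/-- `u` (with pressure `p`) is a classical solution, on the time set `I`, of the Euler equation
`∂u/∂t + ∇_u u = Ω χ J u - ∇p`, `div u = 0` for a tangent vector field on `M`. -/
structure IsEulerSolution (M : Set E3) (ν : E3 → E3) (Ω : ℝ) (I : Set ℝ)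
    (u : ℝ → E3 → E3) (p : ℝ → E3 → ℝ) : Prop where
  contDiffOn_u : ContDiffOn ℝ 1 (fun z : ℝ × E3 => u z.1 z.2) (I ×ˢ M)
  contDiffOn_p : ∀ t ∈ I, ContDiffOn ℝ 1 (p t) M
  tangent : ∀ t ∈ I, ∀ x ∈ M, u t x ∈ tangentAt M x
  momentum : ∀ t ∈ I, ∀ x ∈ M,
    derivWithin (fun s => u s x) I t + convect M (u t) x =
      (Ω * chi ν x) • rotJ ν x (u t x) - surfGrad M (p t) x
  incompressible : ∀ t ∈ I, ∀ x ∈ M, surfDiv M (u t) x = 0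

end SurfaceEuler

end

open SurfaceEuler

/-! The integral is the angular momentum of the fluid about the `x₃`-axis, and the rotational
symmetry conserves it. Since `div (Ju) = -w` and `⟨∇ξ, Ju⟩ = -⟨J∇ξ, u⟩ = ⟨X₃, u⟩`, one has `ξ w =
⟨X₃, u⟩ - div (ξ Ju)` (`mul_vorticity_eq`), so `∫ ξ w = ∫ ⟨X₃, u⟩`.

The density `⟨X₃, ∂ₜu⟩` is a divergence (`inner_X3_momentum`), because each term of the Euler
equation paired with `X₃` is one. `X₃` is a Killing field and `div u = 0`, so `⟨X₃, ∇_u u⟩ = div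
(⟨X₃, u⟩ u)`. With `r` the distance to the axis, the Coriolis term satisfies `χ ⟨X₃, Ju⟩ =
d(r²/2)(u) = div ((r²/2) u)`. Finally `⟨X₃, ∇p⟩ = div (p X₃)`, because `div X₃ = 0`. Hence the time
derivative of `∫ ⟨X₃, u⟩` vanishes.

The analytic burden is the divergence theorem on a compact surface carrying two-dimensional
Hausdorff measure (`IsTangentField.integral_surfDiv`). A partition of unity reduces it to one chart.
There the area formula turns the integral into a planar one, whose integrand is the Euclidean
divergence of a compactly supported flux (`sum_fderiv_flux`). -/

noncomputable section

namespace SurfaceEuler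

open scoped NNReal ENNReal

/-! ### Area formula for Hausdorff measure -/

section AreaFormula

/-- The estimate makes `f ∘ g⁻¹` well defined and `K`-Lipschitz on `g '' A`, even if `g` is not
injective, and a `K`-Lipschitz map multiplies `d`-dimensional Hausdorff measure by at most `K ^ d`.
It serves to compare an immersion with its linearization, in both directions. -/
theorem euclideanHausdorffMeasure_image_le_image {α X Y : Type*} [EMetricSpace X] [EMetricSpace Y]
    [MeasurableSpace X] [BorelSpace X] [MeasurableSpace Y] [BorelSpace Y]
    {f : α → X} {g : α → Y} {A : Set α} {K : ℝ≥0} (d : ℕ)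
    (h : ∀ x ∈ A, ∀ y ∈ A, edist (f x) (f y) ≤ K * edist (g x) (g y)) :
    μHE[d] (f '' A) ≤ (K : ℝ≥0∞) ^ d * μHE[d] (g '' A) := by
  rcases A.eq_empty_or_nonempty with rfl | ⟨a, -⟩
  · simp
  have : Nonempty α := ⟨a⟩
  have hinv : ∀ z ∈ g '' A, Function.invFunOn g A z ∈ A ∧ g (Function.invFunOn g A z) = z :=
    fun z hz => ⟨Function.invFunOn_mem hz, Function.invFunOn_eq hz⟩
  have hL : LipschitzOnWith K (f ∘ Function.invFunOn g A) (g '' A) := by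
    intro z hz z' hz'
    have := h _ (hinv z hz).1 _ (hinv z' hz').1
    rwa [(hinv z hz).2, (hinv z' hz').2] at this
  have himg : (f ∘ Function.invFunOn g A) '' (g '' A) = f '' A := by
    rw [image_comp]
    apply Subset.antisymm
    · rintro _ ⟨_, ⟨z, hz, rfl⟩, rfl⟩
      exact mem_image_of_mem _ (hinv z hz).1
    · rintro _ ⟨x, hx, rfl⟩
      have hz := hinv _ (mem_image_of_mem g hx)
      refine ⟨_, ⟨_, mem_image_of_mem g hx, rfl⟩, ?_⟩
      have := h _ hz.1 _ hx
      rw [hz.2, edist_self, mul_zero, nonpos_iff_eq_zero, edist_eq_zero] at this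
      exact this
  have := hL.hausdorffMeasure_image_le (d := d) (by positivity)
  rw [himg, ENNReal.rpow_natCast] at this
  simp only [Measure.euclideanHausdorffMeasure_def, Measure.smul_apply,
    Measure.nnreal_smul_coe_apply]
  calc _ ≤ _ := mul_le_mul_right this _
    _ = _ := mul_left_comm _ _ _

/-- Strict differentiability bounds the difference of the increments of `φ` and `L` by `δ ‖a - b‖`,
and injectivity of `L` bounds `‖a - b‖` by `C ‖L a - L b‖`. The relative error `δ C` can be made as
small as desired. -/
theorem exists_nhds_dist_comparison {U V : Type*} [NormedAddCommGroup U] [InnerProductSpace ℝ U]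
    [FiniteDimensional ℝ U] [NormedAddCommGroup V] [InnerProductSpace ℝ V]
    {φ : U → V} {L : U →L[ℝ] V} {y : U}
    (hφ : HasStrictFDerivAt φ L y) (hL : Function.Injective L) {K : ℝ≥0} (hK : 1 < K) :
    ∃ N ∈ 𝓝 y, (∀ a ∈ N, ∀ b ∈ N, edist (φ a) (φ b) ≤ K * edist (L a) (L b)) ∧
      ∀ a ∈ N, ∀ b ∈ N, edist (L a) (L b) ≤ K * edist (φ a) (φ b) := by
  obtain ⟨C, hC, hanti⟩ := L.exists_antilipschitzWith (LinearMap.ker_eq_bot.2 hL)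
  obtain ⟨δ, hδ, hδ1, hδ2⟩ : ∃ δ : ℝ≥0, 0 < δ ∧ (1 + δ * C : ℝ) ≤ K ∧ 1 ≤ K * (1 - δ * C : ℝ) := by
    have hK' : (1 : ℝ) < K := by exact_mod_cast hK
    have hC' : (0 : ℝ) < C := by exact_mod_cast hC
    have hpos : 0 < ((K : ℝ) - 1) / (K * C) := by
      apply div_pos <;> [linarith; positivity]
    -- This `δ` solves `K (1 - δ C) = 1`; then `1 + δ C = 1 + (K - 1) / K ≤ K` holds as well.
    refine ⟨⟨((K : ℝ) - 1) / (K * C), hpos.le⟩, by exact_mod_cast hpos, ?_, ?_⟩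
    · show 1 + ((K : ℝ) - 1) / (K * C) * C ≤ K
      have : ((K : ℝ) - 1) / (K * C) * C = ((K : ℝ) - 1) / K := by field_simp
      rw [this]
      have : ((K : ℝ) - 1) / K ≤ K - 1 := div_le_self (by linarith) hK'.le
      linarith
    · show 1 ≤ K * (1 - ((K : ℝ) - 1) / (K * C) * C)
      have : K * (1 - ((K : ℝ) - 1) / (K * C) * C) = 1 := by field_simp; ring
      rw [this]
  obtain ⟨N, hN, happ⟩ := hφ.approximates_deriv_on_nhds (c := δ) (Or.inr hδ)
  have key : ∀ a ∈ N, ∀ b ∈ N, ‖φ a - φ b - (L a - L b)‖ ≤ δ * C * ‖L a - L b‖ := by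
    intro a ha b hb
    have h1 := happ a ha b hb
    rw [map_sub] at h1
    have h2 := hanti.le_mul_dist a b
    rw [dist_eq_norm, dist_eq_norm, L.coe_coe] at h2
    calc _ ≤ δ * ‖a - b‖ := h1
      _ ≤ δ * (C * ‖L a - L b‖) := by gcongr
      _ = _ := by ring
  refine ⟨N, hN, fun a ha b hb => ?_, fun a ha b hb => ?_⟩ <;>
    rw [edist_nndist, edist_nndist, ← ENNReal.coe_mul, ENNReal.coe_le_coe, ← NNReal.coe_le_coe,
      NNReal.coe_mul, coe_nndist, coe_nndist, dist_eq_norm, dist_eq_norm]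
  · have h1 := key a ha b hb
    have h2 := norm_le_norm_add_norm_sub' (φ a - φ b) (L a - L b)
    nlinarith [norm_nonneg (L a - L b)]
  · have h1 := key a ha b hb
    have h2 := norm_sub_norm_le (L a - L b) (φ a - φ b)
    rw [norm_sub_rev (L a - L b)] at h2
    have h3 : (1 - δ * C) * ‖L a - L b‖ ≤ ‖φ a - φ b‖ := by linarith
    nlinarith [norm_nonneg (L a - L b), K.coe_nonneg]

/-- Countably many of the neighbourhoods cover `s`; cutting `A` into disjoint measurable pieces
subordinate to them, the inequality sums up with the same constant. -/
theorem measure_le_mul_of_locally {α : Type*} [TopologicalSpace α] [SecondCountableTopology α]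
    [MeasurableSpace α] [OpensMeasurableSpace α] {m₁ m₂ : Measure α} {s : Set α} {C : ℝ≥0∞}
    (h : ∀ y ∈ s, ∃ N ∈ 𝓝 y, ∀ A ⊆ N ∩ s, MeasurableSet A → m₁ A ≤ C * m₂ A)
    {A : Set α} (hA : MeasurableSet A) (hAs : A ⊆ s) : m₁ A ≤ C * m₂ A := by
  choose! N hN hle using h
  obtain ⟨t, hts, htc, hcov⟩ := TopologicalSpace.countable_cover_nhdsWithin
    (f := fun y => interior (N y)) (s := s)
    (fun y hy => mem_nhdsWithin_of_mem_nhds (interior_mem_nhds.2 (hN y hy)))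
  rcases A.eq_empty_or_nonempty with rfl | hne
  · simp
  have htne : t.Nonempty := by
    obtain ⟨y, hy⟩ := hne
    obtain ⟨i, hi, -⟩ := mem_iUnion₂.1 (hcov (hAs hy))
    exact ⟨i, hi⟩
  obtain ⟨e, he⟩ := htc.exists_eq_range htne
  let B : ℕ → Set α := fun n => A ∩ disjointed (fun k => interior (N (e k))) n
  have hBm : ∀ n, MeasurableSet (B n) := fun n =>
    hA.inter (MeasurableSet.disjointed (fun _ => isOpen_interior.measurableSet) n)
  have hBU : A = ⋃ n, B n := by
    rw [← inter_iUnion, iUnion_disjointed, eq_comm, inter_eq_left]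
    intro y hy
    obtain ⟨i, hi, hy'⟩ := mem_iUnion₂.1 (hcov (hAs hy))
    rw [he] at hi
    obtain ⟨n, rfl⟩ := hi
    exact mem_iUnion.2 ⟨n, hy'⟩
  have hBd : Pairwise (Function.onFun Disjoint B) := fun i j hij =>
    (disjoint_disjointed _ hij).mono inter_subset_right inter_subset_right
  have hBle : ∀ n, m₁ (B n) ≤ C * m₂ (B n) := fun n => by
    refine hle (e n) (hts (he ▸ mem_range_self n)) _ (fun y hy => ⟨?_, hAs hy.1⟩) (hBm n)
    exact interior_subset (disjointed_subset (fun k => interior (N (e k))) n hy.2)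
  rw [hBU, measure_iUnion hBd hBm, measure_iUnion hBd hBm, ← ENNReal.tsum_mul_left]
  exact ENNReal.tsum_le_tsum hBle

variable {U V : Type*} [NormedAddCommGroup U] [InnerProductSpace ℝ U] [FiniteDimensional ℝ U]
  [MeasurableSpace U] [BorelSpace U] [NormedAddCommGroup V] [InnerProductSpace ℝ V]
  [MeasurableSpace V] [BorelSpace V]

/-- The area formula for an injective immersion. -/
theorem euclideanHausdorffMeasure_image_eq_lintegral {φ : U → V} {D : U → U →L[ℝ] V} {J : U → ℝ}
    {s : Set U} (hs : MeasurableSet s) (hφ : ∀ y ∈ s, HasStrictFDerivAt φ (D y) y)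
    (hD : ∀ y ∈ s, Function.Injective (D y)) (hinj : InjOn φ s) (hJ : ContinuousOn J s)
    (hJD : ∀ y ∈ s, J y = (D y).toLinearMap.normDet) {A : Set U} (hA : MeasurableSet A)
    (hAs : A ⊆ s) :
    μHE[Module.finrank ℝ U] (φ '' A) = ∫⁻ y in A, ENNReal.ofReal (J y) := by
  set d := Module.finrank ℝ U with hd
  have hφc : ContinuousOn φ s := fun y hy =>
    (hφ y hy).hasFDerivAt.continuousAt.continuousWithinAt
  have hJpos : ∀ y ∈ s, 0 < J y := fun y hy => by
    rw [hJD y hy]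
    refine lt_of_le_of_ne (LinearMap.normDet_nonneg _) (Ne.symm ?_)
    rw [Ne, LinearMap.normDet_eq_zero_iff_ker_ne_bot, not_not]
    exact LinearMap.ker_eq_bot.2 (hD y hy)
  -- the pull-back of the Hausdorff measure, as a measure on the parameter domain
  have hmeasimg : ∀ B ⊆ s, MeasurableSet B → MeasurableSet (φ '' B) := fun B hB hBm =>
    hBm.image_of_continuousOn_injOn (hφc.mono hB) (hinj.mono hB)
  have hg : MeasurableEmbedding (s.domRestrict φ) := hφc.measurableEmbedding hs hinj
  let m₁ : Measure U := ((μHE[d] : Measure V).comap (s.domRestrict φ)).map (↑)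
  have hm₁ : ∀ B ⊆ s, MeasurableSet B → m₁ B = μHE[d] (φ '' B) := fun B hB hBm => by
    rw [Measure.map_apply measurable_subtype_coe hBm, hg.comap_apply, domRestrict_eq, image_comp,
      Subtype.image_preimage_coe, inter_eq_right.2 hB]
  let m₂ : Measure U := volume.withDensity fun y => ENNReal.ofReal (J y)
  have hlin : ∀ y ∈ s, ∀ B : Set U, μHE[d] (D y '' B) = ENNReal.ofReal (J y) * volume B :=
    fun y hy B => by
      rw [hJD y hy]
      exact LinearMap.euclideanHausdorffMeasure_image_eq_normDet_mul_volume (D y).toLinearMap B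
  -- Of the `d + 1` factors `K`, `d` come from replacing `φ` by its derivative at `y`, and one from
  -- replacing `J` by its value at `y`.
  have hloc : ∀ K : ℝ≥0, 1 < K → ∀ y ∈ s, ∃ N ∈ 𝓝 y, ∀ B ⊆ N ∩ s, MeasurableSet B →
      m₁ B ≤ (K : ℝ≥0∞) ^ (d + 1) * m₂ B ∧ m₂ B ≤ (K : ℝ≥0∞) ^ (d + 1) * m₁ B := by
    intro K hK y hy
    have hK' : (1 : ℝ) < K := by exact_mod_cast hK
    obtain ⟨N, hN, h1, h2⟩ := exists_nhds_dist_comparison (hφ y hy) (hD y hy) hK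
    have hev : ∀ᶠ z in 𝓝[s] y, J y < K * J z ∧ J z < K * J y := by
      have hc := hJ y hy
      refine ((hc.const_mul (K : ℝ)).eventually_const_lt ?_).and (hc.eventually_lt_const ?_)
      all_goals nlinarith [hJpos y hy]
    obtain ⟨N', hN', h3⟩ := mem_nhdsWithin_iff_exists_mem_nhds_inter.1 hev
    refine ⟨N ∩ N', inter_mem hN hN', fun B hB hBm => ?_⟩
    have hBs : B ⊆ s := fun z hz => (hB hz).2
    have e1 : m₁ B ≤ (K : ℝ≥0∞) ^ d * (ENNReal.ofReal (J y) * volume B) := by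
      rw [hm₁ B hBs hBm, ← hlin y hy]
      exact euclideanHausdorffMeasure_image_le_image d
        fun a ha b hb => h1 a (hB ha).1.1 b (hB hb).1.1
    have e2 : ENNReal.ofReal (J y) * volume B ≤ (K : ℝ≥0∞) ^ d * m₁ B := by
      rw [hm₁ B hBs hBm, ← hlin y hy]
      exact euclideanHausdorffMeasure_image_le_image d
        fun a ha b hb => h2 a (hB ha).1.1 b (hB hb).1.1
    have e3 : ENNReal.ofReal (J y) * volume B ≤ K * m₂ B := by
      rw [withDensity_apply _ hBm, ← setLIntegral_const, ← lintegral_const_mul' _ _ (by simp)]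
      refine setLIntegral_mono' hBm fun z hz => ?_
      rw [← ENNReal.ofReal_coe_nnreal, ← ENNReal.ofReal_mul (by simp)]
      exact ENNReal.ofReal_le_ofReal (h3 ⟨(hB hz).1.2, hBs hz⟩).1.le
    have e4 : m₂ B ≤ K * (ENNReal.ofReal (J y) * volume B) := by
      rw [withDensity_apply _ hBm, ← setLIntegral_const, ← lintegral_const_mul' _ _ (by simp)]
      refine setLIntegral_mono' hBm fun z hz => ?_
      rw [← ENNReal.ofReal_coe_nnreal, ← ENNReal.ofReal_mul (by simp)]
      exact ENNReal.ofReal_le_ofReal (h3 ⟨(hB hz).1.2, hBs hz⟩).2.le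
    constructor
    · calc _ ≤ _ := e1
        _ ≤ (K : ℝ≥0∞) ^ d * (K * m₂ B) := by gcongr
        _ = _ := by ring
    · calc _ ≤ _ := e4
        _ ≤ K * ((K : ℝ≥0∞) ^ d * m₁ B) := by gcongr
        _ = _ := by ring
  -- The distortion disappears in the limit `K → 1`.
  have hlim : ∀ a b : ℝ≥0∞, (∀ K : ℝ≥0, 1 < K → a ≤ (K : ℝ≥0∞) ^ (d + 1) * b) → a ≤ b := by
    intro a b hab
    have ht : Tendsto (fun K : ℝ≥0 => (K : ℝ≥0∞) ^ (d + 1) * b) (𝓝[>] 1) (𝓝 (1 * b)) := by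
      refine ENNReal.Tendsto.mul_const ?_ (Or.inl one_ne_zero)
      have : Tendsto (fun K : ℝ≥0 => ((K ^ (d + 1) : ℝ≥0) : ℝ≥0∞)) (𝓝 1)
          (𝓝 ((1 ^ (d + 1) : ℝ≥0) : ℝ≥0∞)) :=
        ENNReal.tendsto_coe.2 ((continuous_pow _).tendsto _)
      simpa using this.mono_left nhdsWithin_le_nhds
    rw [one_mul] at ht
    exact ge_of_tendsto ht (eventually_mem_nhdsWithin.mono fun K hK => hab K hK)
  rw [← hm₁ A hAs hA, ← withDensity_apply _ hA]
  apply le_antisymm <;> refine hlim _ _ fun K hK => ?_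
  · refine measure_le_mul_of_locally (fun y hy => ?_) hA hAs
    obtain ⟨N, hN, h⟩ := hloc K hK y hy
    exact ⟨N, hN, fun B hB hBm => (h B hB hBm).1⟩
  · refine measure_le_mul_of_locally (fun y hy => ?_) hA hAs
    obtain ⟨N, hN, h⟩ := hloc K hK y hy
    exact ⟨N, hN, fun B hB hBm => (h B hB hBm).2⟩

/-- Change of variables for an injective immersion. -/
theorem map_withDensity_eq_restrict_image {φ : U → V} {D : U → U →L[ℝ] V} {J : U → ℝ}
    {s : Set U} (hs : MeasurableSet s) (hφ : ∀ y ∈ s, HasStrictFDerivAt φ (D y) y)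
    (hD : ∀ y ∈ s, Function.Injective (D y)) (hinj : InjOn φ s) (hJ : ContinuousOn J s)
    (hJD : ∀ y ∈ s, J y = (D y).toLinearMap.normDet) :
    (((volume.restrict s).withDensity fun y => ENNReal.ofReal (J y)).comap
      ((↑) : s → U)).map (s.domRestrict φ) =
      (μHE[Module.finrank ℝ U] : Measure V).restrict (φ '' s) := by
  have hφc : ContinuousOn φ s := fun y hy =>
    (hφ y hy).hasFDerivAt.continuousAt.continuousWithinAt
  have hg : MeasurableEmbedding (s.domRestrict φ) := hφc.measurableEmbedding hs hinj
  ext B hB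
  have hB' : MeasurableSet (s ∩ φ ⁻¹' B) := by
    have := (MeasurableEmbedding.subtype_coe hs).measurableSet_image.2 (hg.measurable hB)
    rwa [domRestrict_eq, preimage_comp, Subtype.image_preimage_coe] at this
  rw [hg.map_apply, (MeasurableEmbedding.subtype_coe hs).comap_apply, domRestrict_eq, preimage_comp,
    Subtype.image_preimage_coe, withDensity_apply _ hB', Measure.restrict_restrict hB',
    Measure.restrict_apply hB, inter_eq_left.2 inter_subset_left,
    ← euclideanHausdorffMeasure_image_eq_lintegral hs hφ hD hinj hJ hJD hB' inter_subset_left,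
    image_inter_preimage, inter_comm]

theorem integrableOn_image_iff {φ : U → V} {D : U → U →L[ℝ] V} {J : U → ℝ}
    {s : Set U} (hs : MeasurableSet s) (hφ : ∀ y ∈ s, HasStrictFDerivAt φ (D y) y)
    (hD : ∀ y ∈ s, Function.Injective (D y)) (hinj : InjOn φ s) (hJ : ContinuousOn J s)
    (hJD : ∀ y ∈ s, J y = (D y).toLinearMap.normDet) (f : V → ℝ) :
    IntegrableOn f (φ '' s) (μHE[Module.finrank ℝ U] : Measure V) ↔
      IntegrableOn (fun y => J y * f (φ y)) s := by
  have hφc : ContinuousOn φ s := fun y hy =>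
    (hφ y hy).hasFDerivAt.continuousAt.continuousWithinAt
  have hg : MeasurableEmbedding (s.domRestrict φ) := hφc.measurableEmbedding hs hinj
  have hpos : ∀ y ∈ s, 0 ≤ J y := fun y hy => hJD y hy ▸ LinearMap.normDet_nonneg _
  have he := MeasurableEmbedding.subtype_coe hs
  rw [IntegrableOn, ← map_withDensity_eq_restrict_image hs hφ hD hinj hJ hJD, hg.integrable_map_iff,
    domRestrict_eq, ← Function.comp_assoc, ← he.integrable_map_iff, he.map_comap,
    Subtype.range_coe, restrict_withDensity hs, Measure.restrict_restrict hs, inter_self,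
    integrable_withDensity_iff_integrable_smul₀' (hJ.aemeasurable hs).ennreal_ofReal (by simp)]
  refine integrable_congr ((ae_restrict_mem hs).mono fun y hy => ?_)
  simp [ENNReal.toReal_ofReal (hpos y hy)]

theorem setIntegral_image {φ : U → V} {D : U → U →L[ℝ] V} {J : U → ℝ}
    {s : Set U} (hs : MeasurableSet s) (hφ : ∀ y ∈ s, HasStrictFDerivAt φ (D y) y)
    (hD : ∀ y ∈ s, Function.Injective (D y)) (hinj : InjOn φ s) (hJ : ContinuousOn J s)
    (hJD : ∀ y ∈ s, J y = (D y).toLinearMap.normDet) (f : V → ℝ) :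
    ∫ x in φ '' s, f x ∂(μHE[Module.finrank ℝ U] : Measure V) = ∫ y in s, J y * f (φ y) := by
  have hφc : ContinuousOn φ s := fun y hy =>
    (hφ y hy).hasFDerivAt.continuousAt.continuousWithinAt
  have hg : MeasurableEmbedding (s.domRestrict φ) := hφc.measurableEmbedding hs hinj
  have hpos : ∀ y ∈ s, 0 ≤ J y := fun y hy => hJD y hy ▸ LinearMap.normDet_nonneg _
  have he := MeasurableEmbedding.subtype_coe hs
  rw [← map_withDensity_eq_restrict_image hs hφ hD hinj hJ hJD, hg.integral_map]
  have := he.integral_map (μ := ((volume.restrict s).withDensity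
    fun y => ENNReal.ofReal (J y)).comap ((↑) : s → U)) (fun y => f (φ y))
  simp only [domRestrict_apply]
  rw [← this, he.map_comap,
    Subtype.range_coe, restrict_withDensity hs, Measure.restrict_restrict hs, inter_self,
    integral_withDensity_eq_integral_toReal_smul₀ (hJ.aemeasurable hs).ennreal_ofReal (by simp)]
  refine integral_congr_ae ((ae_restrict_mem hs).mono fun y hy => ?_)
  simp [ENNReal.toReal_ofReal (hpos y hy)]

end AreaFormula

/-! ### Cross product identities -/

section CrossProduct

theorem inner_eq_sum (a b : E3) : inner ℝ a b = a 0 * b 0 + a 1 * b 1 + a 2 * b 2 := by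
  simp [PiLp.inner_apply, Fin.sum_univ_three, mul_comm]

@[simp] theorem cross_apply_zero (a b : E3) : cross a b 0 = a 1 * b 2 - a 2 * b 1 := by
  simp [cross, cross_apply]

@[simp] theorem cross_apply_one (a b : E3) : cross a b 1 = a 2 * b 0 - a 0 * b 2 := by
  simp [cross, cross_apply]

@[simp] theorem cross_apply_two (a b : E3) : cross a b 2 = a 0 * b 1 - a 1 * b 0 := by
  simp [cross, cross_apply]

/-- The cross product as a continuous bilinear map. -/
def crossL : E3 →L[ℝ] E3 →L[ℝ] E3 :=
  LinearMap.toContinuousBilinearMap (LinearMap.mk₂ ℝ cross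
      (fun a b c => by ext i; fin_cases i <;> simp <;> ring)
      (fun r a b => by ext i; fin_cases i <;> simp <;> ring)
      (fun a b c => by ext i; fin_cases i <;> simp <;> ring)
      (fun r a b => by ext i; fin_cases i <;> simp <;> ring))

@[simp] theorem crossL_apply (a b : E3) : crossL a b = cross a b := rfl

theorem cross_swap (a b : E3) : cross b a = -cross a b := by
  ext i; fin_cases i <;> simp <;> ring

theorem inner_cross_swap (n a b : E3) : inner ℝ n (cross b a) = -inner ℝ n (cross a b) := by
  rw [cross_swap, inner_neg_right]

theorem inner_cross_cyclic (a b c : E3) : inner ℝ a (cross b c) = inner ℝ b (cross c a) := by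
  simp only [inner_eq_sum, cross_apply_zero, cross_apply_one, cross_apply_two]; ring

@[simp] theorem inner_cross_self_left (a b : E3) : inner ℝ a (cross a b) = 0 := by
  simp only [inner_eq_sum, cross_apply_zero, cross_apply_one, cross_apply_two]; ring

@[simp] theorem inner_cross_self_right (a b : E3) : inner ℝ b (cross a b) = 0 := by
  simp only [inner_eq_sum, cross_apply_zero, cross_apply_one, cross_apply_two]; ring

@[simp] theorem cross_same (a : E3) : cross a a = 0 := by
  ext i; fin_cases i <;> simp <;> ring

theorem inner_cross_cross (a b c d : E3) : inner ℝ (cross a b) (cross c d) =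
    inner ℝ a c * inner ℝ b d - inner ℝ a d * inner ℝ b c := by
  simp only [inner_eq_sum, cross_apply_zero, cross_apply_one, cross_apply_two]; ring

/-- Three vectors in the plane `n^⊥` are linearly dependent. This removes every term that
differentiates the unit normal. -/
theorem inner_cross_eq_zero_of_orthogonal {n a b c : E3} (hn : n ≠ 0) (ha : inner ℝ n a = 0)
    (hb : inner ℝ n b = 0) (hc : inner ℝ n c = 0) : inner ℝ a (cross b c) = 0 := by
  have h : inner ℝ a (cross b c) * inner ℝ n n = inner ℝ n a * inner ℝ n (cross b c) +
      inner ℝ n b * inner ℝ n (cross c a) + inner ℝ n c * inner ℝ n (cross a b) := by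
    simp only [inner_eq_sum, cross_apply_zero, cross_apply_one, cross_apply_two]; ring
  rw [ha, hb, hc] at h
  simpa [hn] using h

end CrossProduct

/-! ### Tangent planes, frames and the surface divergence -/

section Tangent

variable {M : Set E3} {x : E3}

/-- Derivatives within a surface are not unique as maps on the whole space, but any two agree on the
tangent cone, hence on its span. So any convenient derivative, such as one from the product rule,
may replace `fderivWithin`. -/
theorem fderivWithin_apply_of_mem_tangentAt {F : Type*} [NormedAddCommGroup F] [NormedSpace ℝ F]
    {f : E3 → F} {A : E3 →L[ℝ] F} (h : HasFDerivWithinAt f A M x) {v : E3}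
    (hv : v ∈ tangentAt M x) : fderivWithin ℝ f M x v = A v := by
  have h' := h.differentiableWithinAt.hasFDerivWithinAt
  have : tangentAt M x ≤ (fderivWithin ℝ f M x).toLinearMap.eqLocus A.toLinearMap :=
    Submodule.span_le.2 fun w hw => h'.unique_on h hw
  exact this hv

theorem IsLocalParam.fderiv_mem_tangentAt {U : Set (ℝ × ℝ)} {φ : ℝ × ℝ → E3}
    (h : IsLocalParam M U φ) {y : ℝ × ℝ} (hy : y ∈ U) (v : ℝ × ℝ) :
    fderiv ℝ φ y v ∈ tangentAt M (φ y) := by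
  have hd : HasFDerivAt φ (fderiv ℝ φ y) y :=
    ((h.contDiffOn.contDiffAt (h.isOpen.mem_nhds hy)).differentiableAt (by simp)).hasFDerivAt
  refine Submodule.subset_span (tangentConeAt_mono h.mapsTo.image_subset ?_)
  refine (hd.hasFDerivWithinAt (s := U)).mapsTo_tangent_cone ?_
  rw [tangentConeAt_of_mem_nhds (h.isOpen.mem_nhds hy)]
  trivial

/-- Dimension count: the tangent space lies in the plane `n^⊥` and contains the two-dimensional
range of the derivative of a parametrization. -/
theorem tangentAt_eq_orthogonal (hsurf : IsSmoothSurface M) {n : E3} (hx : x ∈ M) (hn : n ≠ 0)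
    (hT : ∀ v ∈ tangentAt M x, inner ℝ n v = 0) : tangentAt M x = (ℝ ∙ n)ᗮ := by
  obtain ⟨U, φ, h, y, hy, rfl⟩ := hsurf x hx
  have h1 : LinearMap.range (fderiv ℝ φ y).toLinearMap ≤ tangentAt M (φ y) := by
    rintro _ ⟨v, rfl⟩
    exact h.fderiv_mem_tangentAt hy v
  have h2 : Module.finrank ℝ (LinearMap.range (fderiv ℝ φ y).toLinearMap) = 2 := by
    rw [LinearMap.finrank_range_of_inj (h.immersion y hy)]
    simp
  have h3 : Module.finrank ℝ (ℝ ∙ n)ᗮ = 2 := by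
    have : Fact (Module.finrank ℝ E3 = 2 + 1) := ⟨by simp⟩
    exact Submodule.finrank_orthogonal_span_singleton hn
  refine Submodule.eq_of_le_of_finrank_le
    (fun v hv => Submodule.mem_orthogonal_singleton_iff_inner_right.2 (hT v hv)) ?_
  rw [h3, ← h2]
  exact Submodule.finrank_mono h1

/-- An oriented orthonormal frame `e₁`, `e₂` of the tangent space of `M` at `x`, with unit normal
`n`. -/
structure IsTangentFrame (M : Set E3) (x n e₁ e₂ : E3) : Prop where
  mem₁ : e₁ ∈ tangentAt M x
  mem₂ : e₂ ∈ tangentAt M x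
  inner₁₁ : inner ℝ e₁ e₁ = 1
  inner₂₂ : inner ℝ e₂ e₂ = 1
  inner₁₂ : inner ℝ e₁ e₂ = 0
  inner_normal : inner ℝ n n = 1
  normal : ∀ v ∈ tangentAt M x, inner ℝ n v = 0
  inner_cross : inner ℝ n (cross e₁ e₂) = 1
  expand : ∀ v : E3, v = inner ℝ e₁ v • e₁ + inner ℝ e₂ v • e₂ + inner ℝ n v • n
  surfDiv_eq : ∀ (V : E3 → E3) (A : E3 →L[ℝ] E3), HasFDerivWithinAt V A M x →
    surfDiv M V x = inner ℝ e₁ (A e₁) + inner ℝ e₂ (A e₂)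

theorem exists_isTangentFrame {n : E3} (hn : ‖n‖ = 1) (hT : tangentAt M x = (ℝ ∙ n)ᗮ) :
    ∃ e₁ e₂, IsTangentFrame M x n e₁ e₂ := by
  have hn0 : n ≠ 0 := by rintro rfl; simp at hn
  have hnn : inner ℝ n n = 1 := by rw [real_inner_self_eq_norm_sq, hn]; norm_num
  have hfr : Module.finrank ℝ (tangentAt M x) = 2 := by
    have : Fact (Module.finrank ℝ E3 = 2 + 1) := ⟨by simp⟩
    rw [hT]; exact Submodule.finrank_orthogonal_span_singleton hn0
  let b : OrthonormalBasis (Fin 2) ℝ (tangentAt M x) :=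
    (stdOrthonormalBasis ℝ (tangentAt M x)).reindex (finCongr hfr)
  have hperp : ∀ v ∈ tangentAt M x, inner ℝ n v = 0 := fun v hv => by
    rw [hT] at hv
    exact Submodule.mem_orthogonal_singleton_iff_inner_right.1 hv
  have hbb : ∀ i j, inner ℝ (b i : E3) (b j : E3) = if i = j then 1 else 0 := fun i j =>
    orthonormal_iff_ite.1 b.orthonormal i j
  have hexp : ∀ v : E3, v = inner ℝ (b 0 : E3) v • (b 0 : E3) + inner ℝ (b 1 : E3) v • (b 1 : E3)
      + inner ℝ n v • n := by
    intro v
    have hmem : v - inner ℝ n v • n ∈ tangentAt M x := by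
      rw [hT, Submodule.mem_orthogonal_singleton_iff_inner_right, inner_sub_right, inner_smul_right,
        hnn]
      ring
    have h := congrArg (Subtype.val) (b.sum_repr' ⟨_, hmem⟩)
    have h0 : ∀ i, inner ℝ (b i) (⟨_, hmem⟩ : tangentAt M x) = inner ℝ (b i : E3) v := fun i => by
      rw [Submodule.coe_inner, inner_sub_right, inner_smul_right, real_inner_comm n,
        hperp _ (b i).2]
      simp
    rw [Fin.sum_univ_two, h0, h0] at h
    simp only [Submodule.coe_add, Submodule.coe_smul] at h
    rw [h]; simp
  have hdiv : ∀ (V : E3 → E3) (A : E3 →L[ℝ] E3), HasFDerivWithinAt V A M x →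
      surfDiv M V x = inner ℝ (b 0 : E3) (A (b 0)) + inner ℝ (b 1 : E3) (A (b 1)) := by
    intro V A hA
    rw [surfDiv, LinearMap.trace_eq_sum_inner _ b, Fin.sum_univ_two]
    have : ∀ i, inner ℝ (b i) (covDeriv M V x (b i)) = inner ℝ (b i : E3) (A (b i)) := fun i => by
      rw [← fderivWithin_apply_of_mem_tangentAt hA (b i).2]
      simp [covDeriv]
    rw [this, this]
  -- The cross product of the two basis vectors is a multiple of `n`, and Lagrange's identity gives
  -- it length one. If the sign is negative, swapping the vectors corrects the orientation.
  have hσ : inner ℝ n (cross (b 0) (b 1)) ^ 2 = 1 := by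
    have h1 := inner_cross_cross (b 0) (b 1) (b 0) (b 1)
    have h2 := hexp (cross (b 0) (b 1))
    rw [inner_cross_self_left, inner_cross_self_right] at h2
    simp only [zero_smul, zero_add] at h2
    rw [h2, inner_smul_left, inner_smul_right, hnn, hbb, hbb, hbb, hbb] at h1
    simp at h1
    rw [sq]
    simpa using h1
  rcases sq_eq_one_iff.1 hσ with hσ | hσ
  · exact ⟨b 0, b 1, (b 0).2, (b 1).2, (hbb _ _).trans (by simp),
      (hbb _ _).trans (by simp), (hbb _ _).trans (by simp), hnn, hperp, hσ, hexp,
      hdiv⟩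
  · refine ⟨b 1, b 0, (b 1).2, (b 0).2, (hbb _ _).trans (by simp),
      (hbb _ _).trans (by simp), (hbb _ _).trans (by simp), hnn, hperp, ?_,
      fun v => ?_, fun V A hA => ?_⟩
    · rw [inner_cross_swap, hσ, neg_neg]
    · rw [add_comm (inner ℝ (b 1 : E3) v • (b 1 : E3))]
      exact hexp v
    · rw [hdiv V A hA, add_comm]

namespace IsTangentFrame

variable {n e₁ e₂ : E3}

theorem inner_normal_cross (h : IsTangentFrame M x n e₁ e₂) (v w : E3) :
    inner ℝ n (cross v w) =
      inner ℝ e₁ v * inner ℝ e₂ w - inner ℝ e₂ v * inner ℝ e₁ w := by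
  conv_lhs => rw [h.expand v, h.expand w]
  simp only [← crossL_apply, map_add, map_smul, add_apply,
    smul_apply, inner_add_right, inner_smul_right]
  simp only [crossL_apply, inner_cross_self_left, inner_cross_self_right, cross_same,
    inner_zero_right, h.inner_cross, inner_cross_swap n e₁ e₂]
  ring

theorem expand_tangent (h : IsTangentFrame M x n e₁ e₂) {v : E3} (hv : inner ℝ n v = 0) :
    v = inner ℝ e₁ v • e₁ + inner ℝ e₂ v • e₂ := by
  conv_lhs => rw [h.expand v, hv, zero_smul, add_zero]

/-- The trace of an endomorphism of the tangent plane in terms of the area form. -/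
theorem inner_normal_cross_add (h : IsTangentFrame M x n e₁ e₂) {V : E3 → E3} {A : E3 →L[ℝ] E3}
    (hA : HasFDerivWithinAt V A M x) {a b : E3} (ha : inner ℝ n a = 0) (hb : inner ℝ n b = 0) :
    inner ℝ n (cross (A a) b) + inner ℝ n (cross a (A b)) =
      surfDiv M V x * inner ℝ n (cross a b) := by
  have hAa : ∀ e, inner ℝ e (A a) =
      inner ℝ e₁ a * inner ℝ e (A e₁) + inner ℝ e₂ a * inner ℝ e (A e₂) := fun e => by
    conv_lhs => rw [h.expand_tangent ha]
    simp [inner_add_right, inner_smul_right]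
  have hAb : ∀ e, inner ℝ e (A b) =
      inner ℝ e₁ b * inner ℝ e (A e₁) + inner ℝ e₂ b * inner ℝ e (A e₂) := fun e => by
    conv_lhs => rw [h.expand_tangent hb]
    simp [inner_add_right, inner_smul_right]
  rw [h.surfDiv_eq V A hA, h.inner_normal_cross, h.inner_normal_cross, h.inner_normal_cross,
    hAa, hAa, hAb, hAb]
  ring

end IsTangentFrame

end Tangent

/-! ### Charts over the Euclidean plane -/

section Chart

/-- The Euclidean plane. -/
abbrev E2 : Type := EuclideanSpace ℝ (Fin 2)

/-- The standard basis vectors of the plane. -/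
abbrev basisVec (i : Fin 2) : E2 := EuclideanSpace.single i 1

/-- `φ`, on the open set `s` of the Euclidean plane, parametrizes the open piece `W ∩ M` of `M`. -/
structure IsChart (M W : Set E3) (s : Set E2) (φ : E2 → E3) : Prop where
  isOpen_source : IsOpen s
  isOpen_target : IsOpen W
  contDiffOn : ContDiffOn ℝ ∞ φ s
  injOn : InjOn φ s
  immersion : ∀ y ∈ s, Function.Injective (fderiv ℝ φ y)
  image_eq : φ '' s = W ∩ M
  openMap : ∀ V ⊆ s, IsOpen V → ∃ W' : Set E3, IsOpen W' ∧ φ '' V = W' ∩ M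

theorem IsSmoothSurface.exists_isChart {M : Set E3} (hM : IsSmoothSurface M) {x : E3}
    (hx : x ∈ M) : ∃ W s φ, IsChart M W s φ ∧ x ∈ W := by
  obtain ⟨U, φ, h, y, hy, rfl⟩ := hM x hx
  let e : E2 ≃L[ℝ] ℝ × ℝ :=
    (EuclideanSpace.equiv (Fin 2) ℝ).trans (ContinuousLinearEquiv.finTwoArrow ℝ ℝ)
  obtain ⟨W, hW, hUW⟩ := h.openMap U Subset.rfl h.isOpen
  have himg : ∀ V : Set E2, (φ ∘ e) '' V = φ '' (e '' V) := fun V => image_comp φ e V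
  refine ⟨W, e ⁻¹' U, φ ∘ e, ⟨h.isOpen.preimage e.continuous, hW,
    h.contDiffOn.comp e.contDiff.contDiffOn (mapsTo_preimage _ _), ?_, fun z hz => ?_, ?_,
    fun V hV hVo => ?_⟩, ?_⟩
  · exact h.injOn.comp e.injective.injOn (mapsTo_preimage _ _)
  · rw [e.comp_right_fderiv]
    exact (h.immersion _ hz).comp e.injective
  · rw [himg, image_preimage_eq _ e.surjective, hUW]
  · rw [himg]
    exact h.openMap _ (image_subset_iff.2 hV) (e.toHomeomorph.isOpenMap V hVo)
  · exact (hUW ▸ mem_image_of_mem φ hy : φ y ∈ W ∩ M).1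

/-- The partial derivatives of `φ`. -/
def partialDeriv (φ : E2 → E3) (i : Fin 2) (y : E2) : E3 := fderiv ℝ φ y (basisVec i)

/-- The normal vector `∂₀φ × ∂₁φ`. -/
def normalVec (φ : E2 → E3) (y : E2) : E3 := cross (partialDeriv φ 0 y) (partialDeriv φ 1 y)

/-- Both sides are nonnegative with square the Gram determinant of the partial derivatives, by
Lagrange's identity. This identifies the Jacobian of the area formula. -/
theorem norm_normalVec_eq (φ : E2 → E3) (y : E2) :
    ‖normalVec φ y‖ = (fderiv ℝ φ y).toLinearMap.normDet := by
  have h1 := LinearMap.normDet_sq_eq_det_gram (fderiv ℝ φ y).toLinearMap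
    (EuclideanSpace.basisFun (Fin 2) ℝ)
  have h2 : ‖normalVec φ y‖ ^ 2 = (fderiv ℝ φ y).toLinearMap.normDet ^ 2 := by
    rw [← real_inner_self_eq_norm_sq, normalVec, inner_cross_cross]
    have h3 : (fderiv ℝ φ y).toLinearMap.normDet ^ 2 = _ := h1
    rw [h3, Matrix.det_fin_two]
    simp [Matrix.gram_apply, partialDeriv]
  exact (pow_left_inj₀ (norm_nonneg _) (LinearMap.normDet_nonneg _) two_ne_zero).1 h2

namespace IsChart

variable {M W : Set E3} {s : Set E2} {φ : E2 → E3}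

theorem contDiffAt (h : IsChart M W s φ) {y : E2} (hy : y ∈ s) : ContDiffAt ℝ ∞ φ y :=
  h.contDiffOn.contDiffAt (h.isOpen_source.mem_nhds hy)

theorem hasStrictFDerivAt (h : IsChart M W s φ) {y : E2} (hy : y ∈ s) :
    HasStrictFDerivAt φ (fderiv ℝ φ y) y :=
  (h.contDiffAt hy).hasStrictFDerivAt (by simp)

theorem contDiffAt_fderiv (h : IsChart M W s φ) {y : E2} (hy : y ∈ s) :
    ContDiffAt ℝ ∞ (fderiv ℝ φ) y :=
  (h.contDiffAt hy).fderiv_right (by simp)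

theorem contDiffAt_partialDeriv (h : IsChart M W s φ) (i : Fin 2) {y : E2} (hy : y ∈ s) :
    ContDiffAt ℝ ∞ (partialDeriv φ i) y :=
  (h.contDiffAt_fderiv hy).clm_apply contDiffAt_const

theorem contDiffAt_normalVec (h : IsChart M W s φ) {y : E2} (hy : y ∈ s) :
    ContDiffAt ℝ ∞ (normalVec φ) y := by
  have := ((crossL.contDiff.contDiffAt (x := partialDeriv φ 0 y)).comp y
    (h.contDiffAt_partialDeriv 0 hy)).clm_apply (h.contDiffAt_partialDeriv 1 hy)
  exact this

theorem mem_target (h : IsChart M W s φ) {y : E2} (hy : y ∈ s) :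
    φ y ∈ W ∩ M := h.image_eq ▸ mem_image_of_mem φ hy

theorem normalVec_ne_zero (h : IsChart M W s φ) {y : E2} (hy : y ∈ s) : normalVec φ y ≠ 0 := by
  rw [← norm_ne_zero_iff, norm_normalVec_eq, Ne, LinearMap.normDet_eq_zero_iff_ker_ne_bot,
    not_not]
  exact LinearMap.ker_eq_bot.2 (h.immersion y hy)

theorem partialDeriv_mem_tangentAt (h : IsChart M W s φ) (i : Fin 2) {y : E2} (hy : y ∈ s) :
    partialDeriv φ i y ∈ tangentAt M (φ y) := by
  refine Submodule.subset_span (tangentConeAt_mono (s := φ '' s) ?_ ?_)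
  · rw [h.image_eq]; exact inter_subset_right
  refine ((h.hasStrictFDerivAt hy).hasFDerivAt.hasFDerivWithinAt (s := s)).mapsTo_tangent_cone ?_
  rw [tangentConeAt_of_mem_nhds (h.isOpen_source.mem_nhds hy)]
  trivial

/-- The inverse of the chart is continuous because `φ` is open onto its image. This makes the
support of a field compact in the parameter domain. -/
theorem isCompact_preimage (h : IsChart M W s φ) {K : Set E3} (hK : IsCompact K) (hKW : K ⊆ W ∩ M) :
    IsCompact (s ∩ φ ⁻¹' K) := by
  have hinv : ∀ y ∈ s, Function.invFunOn φ s (φ y) = y := fun y hy =>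
    h.injOn.leftInvOn_invFunOn hy
  have hc : ContinuousOn (Function.invFunOn φ s) (W ∩ M) := by
    rw [← h.image_eq]
    rintro _ ⟨y, hy, rfl⟩
    rw [ContinuousWithinAt, hinv y hy]
    intro N hN
    obtain ⟨V, hVN, hVo, hyV⟩ := mem_nhds_iff.1 (inter_mem hN (h.isOpen_source.mem_nhds hy))
    obtain ⟨W', hW'o, hW'⟩ := h.openMap V (fun z hz => (hVN hz).2) hVo
    refine mem_nhdsWithin.2 ⟨W', hW'o, (hW' ▸ mem_image_of_mem φ hyV : φ y ∈ W' ∩ M).1, ?_⟩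
    rintro _ ⟨hz, z, hzs, rfl⟩
    obtain ⟨z', hz', hzz'⟩ : φ z ∈ φ '' V := hW' ▸ ⟨hz, (h.mem_target hzs).2⟩
    rw [h.injOn (hVN hz').2 hzs hzz'] at hz'
    rw [mem_preimage, hinv z hzs]
    exact (hVN hz').1
  have : s ∩ φ ⁻¹' K = Function.invFunOn φ s '' K := by
    ext y
    constructor
    · exact fun hy => ⟨φ y, hy.2, hinv y hy.1⟩
    · rintro ⟨z, hz, rfl⟩
      obtain ⟨y, hy, rfl⟩ : z ∈ φ '' s := h.image_eq ▸ hKW hz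
      rw [hinv y hy]
      exact ⟨hy, hz⟩
  rw [this]
  exact hK.image_of_continuousOn (hc.mono hKW)

end IsChart

/-! ### The divergence theorem on a compact surface -/

section Divergence

theorem integral_fderiv_apply_eq_zero {E : Type*} [NormedAddCommGroup E] [NormedSpace ℝ E]
    [FiniteDimensional ℝ E] [MeasurableSpace E] [BorelSpace E] (μ : Measure E) [μ.IsAddHaarMeasure]
    {G : E → ℝ} (hG : ContDiff ℝ 1 G) (hc : HasCompactSupport G) (v : E) :
    ∫ y, fderiv ℝ G y v ∂μ = 0 := by
  have hint : Integrable (fun y => fderiv ℝ G y v) μ :=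
    ((hG.continuous_fderiv one_ne_zero).clm_apply continuous_const).integrable_of_hasCompactSupport
      (hc.fderiv_apply ℝ v)
  -- Integration by parts against the constant function `1`.
  have := integral_bilinear_hasLineDerivAt_right_eq_neg_left_of_integrable (μ := μ) (v := v)
    (f := fun _ : E => (1 : ℝ)) (f' := fun _ => (0 : ℝ)) (g := G) (g' := fun y => fderiv ℝ G y v)
    (B := ContinuousLinearMap.mul ℝ ℝ) (by simp) (by simpa using hint)
    (by simpa using hG.continuous.integrable_of_hasCompactSupport hc)
    (fun y _ => by simpa using (hasFDerivAt_const (1 : ℝ) y).hasLineDerivAt v)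
    (fun y _ => (hG.differentiable one_ne_zero y).hasFDerivAt.hasLineDerivAt v)
  simpa using this

/-- `V` is a tangent vector field on `M` of class `C^1`. -/
structure IsTangentField (M : Set E3) (V : E3 → E3) : Prop where
  contDiffOn : ContDiffOn ℝ 1 V M
  mem : ∀ x ∈ M, V x ∈ tangentAt M x

/-- The unit normal of a parametrized surface. -/
def unitNormal (φ : E2 → E3) (y : E2) : E3 := ‖normalVec φ y‖⁻¹ • normalVec φ y

theorem IsSmoothSurface.exists_isTangentFrame {M : Set E3} (hsurf : IsSmoothSurface M)
    (hM : ∀ x ∈ M, ∃ n : E3, n ≠ 0 ∧ ∀ v ∈ tangentAt M x, inner ℝ n v = 0) {x : E3} (hx : x ∈ M) :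
    ∃ n e₁ e₂, IsTangentFrame M x n e₁ e₂ := by
  obtain ⟨n, hn, hnT⟩ := hM x hx
  have hn1 : ‖(‖n‖⁻¹ • n : E3)‖ = 1 := by
    rw [norm_smul, norm_inv, norm_norm, inv_mul_cancel₀ (norm_ne_zero_iff.2 hn)]
  exact ⟨_, SurfaceEuler.exists_isTangentFrame hn1 (tangentAt_eq_orthogonal hsurf hx
    (by rw [← norm_ne_zero_iff, hn1]; exact one_ne_zero)
    fun v hv => by rw [inner_smul_left, hnT v hv, mul_zero])⟩

/-- The components of the area form contracted with the vector field `V`. -/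
def flux (φ : E2 → E3) (V : E3 → E3) : Fin 2 → E2 → ℝ :=
  ![fun y => inner ℝ (unitNormal φ y) (cross (V (φ y)) (partialDeriv φ 1 y)),
    fun y => inner ℝ (unitNormal φ y) (cross (partialDeriv φ 0 y) (V (φ y)))]

namespace IsChart

variable {M W : Set E3} {s : Set E2} {φ : E2 → E3}

theorem contDiffAt_unitNormal (h : IsChart M W s φ) {y : E2} (hy : y ∈ s) :
    ContDiffAt ℝ ∞ (unitNormal φ) y :=
  (((h.contDiffAt_normalVec hy).norm ℝ (h.normalVec_ne_zero hy)).inv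
    (norm_ne_zero_iff.2 (h.normalVec_ne_zero hy))).smul (h.contDiffAt_normalVec hy)

theorem norm_unitNormal (h : IsChart M W s φ) {y : E2} (hy : y ∈ s) : ‖unitNormal φ y‖ = 1 := by
  rw [unitNormal, norm_smul, norm_inv, norm_norm,
    inv_mul_cancel₀ (norm_ne_zero_iff.2 (h.normalVec_ne_zero hy))]

theorem contDiffAt_comp (h : IsChart M W s φ) {V : E3 → E3} (hV : ContDiffOn ℝ 1 V M) {y : E2}
    (hy : y ∈ s) : ContDiffAt ℝ 1 (fun y => V (φ y)) y :=
  (hV.comp (h.contDiffOn.of_le (by simp)) fun _ hz => (h.mem_target hz).2).contDiffAt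
    (h.isOpen_source.mem_nhds hy)

theorem contDiffAt_flux (h : IsChart M W s φ) {V : E3 → E3} (hV : ContDiffOn ℝ 1 V M) {y : E2}
    (hy : y ∈ s) (i : Fin 2) : ContDiffAt ℝ 1 (flux φ V i) y := by
  have hn : ContDiffAt ℝ 1 (unitNormal φ) y := (h.contDiffAt_unitNormal hy).of_le (by simp)
  have hp : ∀ i, ContDiffAt ℝ 1 (partialDeriv φ i) y := fun i =>
    (h.contDiffAt_partialDeriv i hy).of_le (by simp)
  have hF := h.contDiffAt_comp hV hy
  fin_cases i
  · exact hn.inner ℝ (((crossL.contDiff.contDiffAt).comp y hF).clm_apply (hp 1))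
  · exact hn.inner ℝ (((crossL.contDiff.contDiffAt).comp y (hp 0)).clm_apply hF)

theorem inner_unitNormal (h : IsChart M W s φ)
    (hM : ∀ x ∈ M, ∃ n : E3, n ≠ 0 ∧ ∀ v ∈ tangentAt M x, inner ℝ n v = 0) {y : E2} (hy : y ∈ s)
    {v : E3} (hv : v ∈ tangentAt M (φ y)) : inner ℝ (unitNormal φ y) v = 0 := by
  obtain ⟨n, hn, hnT⟩ := hM (φ y) (h.mem_target hy).2
  rw [unitNormal, inner_smul_left, real_inner_comm, normalVec,
    inner_cross_eq_zero_of_orthogonal hn (hnT v hv) (hnT _ (h.partialDeriv_mem_tangentAt 0 hy))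
      (hnT _ (h.partialDeriv_mem_tangentAt 1 hy)), mul_zero]

/-- This is the coordinate form of `d(ι_V α) = (div V) α`. The product rule leaves the two terms in
the derivative of `V`, which form a trace by `inner_normal_cross_add`; the others vanish or cancel.
-/
theorem sum_fderiv_flux (h : IsChart M W s φ) (hsurf : IsSmoothSurface M)
    (hM : ∀ x ∈ M, ∃ n : E3, n ≠ 0 ∧ ∀ v ∈ tangentAt M x, inner ℝ n v = 0) {V : E3 → E3}
    (hV : IsTangentField M V) {y : E2} (hy : y ∈ s) :
    fderiv ℝ (flux φ V 0) y (basisVec 0) + fderiv ℝ (flux φ V 1) y (basisVec 1) =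
      ‖normalVec φ y‖ * surfDiv M V (φ y) := by
  have hx := (h.mem_target hy).2
  have hA : HasFDerivWithinAt V (fderivWithin ℝ V M (φ y)) M (φ y) :=
    ((hV.contDiffOn _ hx).differentiableWithinAt one_ne_zero).hasFDerivWithinAt
  set A := fderivWithin ℝ V M (φ y)
  have hn0 : unitNormal φ y ≠ 0 := by
    rw [← norm_ne_zero_iff, h.norm_unitNormal hy]; exact one_ne_zero
  obtain ⟨e₁, e₂, hfr⟩ := exists_isTangentFrame (h.norm_unitNormal hy)
    (tangentAt_eq_orthogonal hsurf hx hn0 fun v hv => h.inner_unitNormal hM hy hv)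
  have hF : HasFDerivAt (fun y => V (φ y)) (A ∘L fderiv ℝ φ y) y := by
    have h1 := hA.comp y (h.hasStrictFDerivAt hy).hasFDerivAt.hasFDerivWithinAt
      (fun z hz => (h.mem_target hz).2 : MapsTo φ s M)
    exact h1.hasFDerivAt (h.isOpen_source.mem_nhds hy)
  have hn : HasFDerivAt (unitNormal φ) (fderiv ℝ (unitNormal φ) y) y :=
    ((h.contDiffAt_unitNormal hy).differentiableAt (by simp)).hasFDerivAt
  have hp : ∀ i, HasFDerivAt (partialDeriv φ i)
      ((ContinuousLinearMap.apply ℝ E3 (basisVec i)) ∘L fderiv ℝ (fderiv ℝ φ) y) y := fun i =>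
    (ContinuousLinearMap.apply ℝ E3 (basisVec i)).hasFDerivAt.comp y
      ((h.contDiffAt_fderiv hy).differentiableAt (by simp)).hasFDerivAt
  have hsymm := ((h.contDiffAt hy).isSymmSndFDerivAt
    (by simpa using WithTop.coe_le_coe.2 (le_top (a := (2 : ℕ∞))))) (basisVec 0) (basisVec 1)
  -- A unit vector field has derivative orthogonal to itself.
  have hn' : ∀ v, inner ℝ (unitNormal φ y) (fderiv ℝ (unitNormal φ) y v) = 0 := by
    intro v
    have h1 : HasFDerivAt (fun z => inner ℝ (unitNormal φ z) (unitNormal φ z)) _ y :=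
      hn.inner ℝ hn
    have h2 : (fun z => inner ℝ (unitNormal φ z) (unitNormal φ z)) =ᶠ[𝓝 y] fun _ => (1 : ℝ) := by
      filter_upwards [h.isOpen_source.mem_nhds hy] with z hz
      rw [real_inner_self_eq_norm_sq, h.norm_unitNormal hz, one_pow]
    have h3 := congrArg (fun L => L v)
      (h1.unique ((hasFDerivAt_const (1 : ℝ) y).congr_of_eventuallyEq h2))
    simp only [ContinuousLinearMap.comp_apply, ContinuousLinearMap.prod_apply, fderivInnerCLM_apply,
      zero_apply] at h3
    rw [real_inner_comm (unitNormal φ y)] at h3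
    linarith
  have hpT : ∀ i, inner ℝ (unitNormal φ y) (partialDeriv φ i y) = 0 := fun i =>
    h.inner_unitNormal hM hy (h.partialDeriv_mem_tangentAt i hy)
  have hVT : inner ℝ (unitNormal φ y) (V (φ y)) = 0 := h.inner_unitNormal hM hy (hV.mem _ hx)
  have h0 : HasFDerivAt (flux φ V 0) _ y :=
    hn.inner ℝ (crossL.hasFDerivAt_of_bilinear hF (hp 1))
  have h1 : HasFDerivAt (flux φ V 1) _ y :=
    hn.inner ℝ (crossL.hasFDerivAt_of_bilinear (hp 0) hF)
  have hJ : inner ℝ (unitNormal φ y) (cross (partialDeriv φ 0 y) (partialDeriv φ 1 y)) =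
      ‖normalVec φ y‖ := by
    show inner ℝ (unitNormal φ y) (normalVec φ y) = _
    rw [unitNormal, inner_smul_left, real_inner_self_eq_norm_sq]
    have := norm_ne_zero_iff.2 (h.normalVec_ne_zero hy)
    simp only [map_inv₀, conj_trivial]
    field_simp
  have key := hfr.inner_normal_cross_add hA (hpT 0) (hpT 1)
  rw [hJ] at key
  rw [h0.fderiv, h1.fderiv, mul_comm, ← key]
  simp only [ContinuousLinearMap.comp_apply, ContinuousLinearMap.prod_apply, fderivInnerCLM_apply,
    add_apply, ContinuousLinearMap.precompR_apply, ContinuousLinearMap.precompL_apply,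
    ContinuousLinearMap.compL_apply, crossL_apply, inner_add_right,
    ContinuousLinearMap.apply_apply]
  -- Terms with the derivative of the normal are triple products of tangent vectors. The two mixed
  -- second derivatives of `φ` cancel by symmetry and antisymmetry of the cross product.
  rw [inner_cross_eq_zero_of_orthogonal hn0 (hn' _) hVT (hpT 1),
    inner_cross_eq_zero_of_orthogonal hn0 (hn' _) (hpT 0) hVT, hsymm,
    inner_cross_swap _ (V (φ y))]
  simp only [partialDeriv]
  ring

/-- The divergence theorem for vector fields supported in the domain of a chart. -/
theorem integral_surfDiv (h : IsChart M W s φ) (hsurf : IsSmoothSurface M) (hMc : IsCompact M)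
    (hM : ∀ x ∈ M, ∃ n : E3, n ≠ 0 ∧ ∀ v ∈ tangentAt M x, inner ℝ n v = 0) {V : E3 → E3}
    (hV : IsTangentField M V) {C : Set E3} (hC : IsClosed C) (hCW : C ⊆ W)
    (hVC : ∀ x ∈ M, x ∉ C → V x = 0) :
    IntegrableOn (surfDiv M V) M (μHE[2] : Measure E3) ∧
      ∫ x in M, surfDiv M V x ∂(μHE[2] : Measure E3) = 0 := by
  have hK : IsCompact (s ∩ φ ⁻¹' (M ∩ C)) :=
    h.isCompact_preimage (hMc.inter_right hC) fun x hx => ⟨hCW hx.2, hx.1⟩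
  set K := s ∩ φ ⁻¹' (M ∩ C) with hKdef
  have hV0 : ∀ y ∈ s, y ∉ K → V (φ y) = 0 := fun y hy hyK =>
    hVC _ (h.mem_target hy).2 fun hC' => hyK ⟨hy, (h.mem_target hy).2, hC'⟩
  -- Extension by zero stays `C¹`: the flux vanishes off the compact set `K`, which lies in the open
  -- set `s`.
  let G : Fin 2 → E2 → ℝ := fun i => s.indicator (flux φ V i)
  have hG0 : ∀ i, ∀ y ∉ K, G i y = 0 := by
    intro i y hy
    by_cases hys : y ∈ s
    · simp only [G, indicator_of_mem hys]
      fin_cases i <;> simp [flux, hV0 y hys hy, ← crossL_apply]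
    · exact indicator_of_notMem hys _
  have hGeq : ∀ i, ∀ y ∈ s, G i =ᶠ[𝓝 y] flux φ V i := fun i y hy => by
    filter_upwards [h.isOpen_source.mem_nhds hy] with z hz
    exact indicator_of_mem hz _
  have hGzero : ∀ i, ∀ y ∉ K, G i =ᶠ[𝓝 y] fun _ => 0 := fun i y hy => by
    filter_upwards [hK.isClosed.isOpen_compl.mem_nhds hy] with z hz
    exact hG0 i z hz
  have hGc : ∀ i, HasCompactSupport (G i) := fun i => HasCompactSupport.intro hK (hG0 i)
  have hGd : ∀ i, ContDiff ℝ 1 (G i) := fun i => contDiff_iff_contDiffAt.2 fun y => by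
    by_cases hy : y ∈ s
    · exact (h.contDiffAt_flux hV.contDiffOn hy i).congr_of_eventuallyEq (hGeq i y hy)
    · exact contDiffAt_const.congr_of_eventuallyEq (hGzero i y fun hyK => hy hyK.1)
  have hint : ∀ i v, Integrable (fun y => fderiv ℝ (G i) y v) := fun i v =>
    (((hGd i).continuous_fderiv one_ne_zero).clm_apply
      continuous_const).integrable_of_hasCompactSupport ((hGc i).fderiv_apply ℝ v)
  let D : E2 → ℝ := fun y => fderiv ℝ (G 0) y (basisVec 0) + fderiv ℝ (G 1) y (basisVec 1)
  have hDint : Integrable D := (hint 0 _).add (hint 1 _)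
  have hD0 : ∫ y, D y = 0 := by
    rw [integral_add (hint 0 _) (hint 1 _), integral_fderiv_apply_eq_zero _ (hGd 0) (hGc 0),
      integral_fderiv_apply_eq_zero _ (hGd 1) (hGc 1), add_zero]
  have hDs : ∀ y ∈ s, ‖normalVec φ y‖ * surfDiv M V (φ y) = D y := fun y hy => by
    rw [← h.sum_fderiv_flux hsurf hM hV hy]
    simp only [D, (hGeq _ y hy).fderiv_eq]
  have hDcompl : ∀ y ∉ s, D y = 0 := fun y hy => by
    have hyK : y ∉ K := fun hyK => hy hyK.1
    simp [D, (hGzero _ y hyK).fderiv_eq]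
  have hJc : ContinuousOn (fun y => ‖normalVec φ y‖) s := fun y hy =>
    (h.contDiffAt_normalVec hy).continuousAt.norm.continuousWithinAt
  have hsm := h.isOpen_source.measurableSet
  have hst : ∀ y ∈ s, HasStrictFDerivAt φ (fderiv ℝ φ y) y := fun y hy => h.hasStrictFDerivAt hy
  have hJn : ∀ y ∈ s, ‖normalVec φ y‖ = (fderiv ℝ φ y).toLinearMap.normDet := fun y _ =>
    norm_normalVec_eq φ y
  have hfin : Module.finrank ℝ E2 = 2 := by simp
  have hi := integrableOn_image_iff hsm hst h.immersion h.injOn hJc hJn (surfDiv M V)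
  have he := setIntegral_image hsm hst h.immersion h.injOn hJc hJn (surfDiv M V)
  rw [hfin] at hi he
  have hdiv0 : ∀ x ∈ M, x ∉ C → surfDiv M V x = 0 := by
    intro x hx hxC
    obtain ⟨n, e₁, e₂, hfr⟩ := hsurf.exists_isTangentFrame hM hx
    have h0 : HasFDerivWithinAt V (0 : E3 →L[ℝ] E3) M x := by
      refine (hasFDerivWithinAt_const (0 : E3) x M).congr_of_eventuallyEq ?_ (hVC x hx hxC)
      filter_upwards [self_mem_nhdsWithin,
        mem_nhdsWithin_of_mem_nhds (hC.isOpen_compl.mem_nhds hxC)] with z hz hzC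
      exact hVC z hz hzC
    rw [hfr.surfDiv_eq V 0 h0]
    simp
  have hdiff : ∀ x ∈ M \ (φ '' s), surfDiv M V x = 0 := fun x hx =>
    hdiv0 x hx.1 fun hxC => hx.2 (h.image_eq ▸ ⟨hCW hxC, hx.1⟩)
  have hsub : φ '' s ⊆ M := h.image_eq ▸ inter_subset_right
  constructor
  · have : IntegrableOn (surfDiv M V) (φ '' s) (μHE[2] : Measure E3) :=
      hi.2 ((hDint.integrableOn (s := s)).congr_fun (fun y hy => (hDs y hy).symm) hsm)
    exact this.of_forall_sdiff_eq_zero hMc.measurableSet hdiff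
  · rw [setIntegral_eq_of_subset_of_forall_sdiff_eq_zero hMc.measurableSet hsub hdiff, he,
      setIntegral_congr_fun hsm hDs, setIntegral_eq_integral_of_forall_compl_eq_zero hDcompl, hD0]

end IsChart

/-- Two-dimensional Hausdorff measure is not locally finite on three-space, so finiteness comes from
the charts: a small disc has an image of finite area, since the Jacobian is bounded on its closure.
-/
theorem IsSmoothSurface.measure_lt_top_of_isCompact {M : Set E3} (hsurf : IsSmoothSurface M)
    (hMc : IsCompact M) : (μHE[2] : Measure E3) M < ⊤ := by
  refine hMc.measure_lt_top_of_nhdsWithin fun x hx => ?_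
  obtain ⟨W, s, φ, h, hxW⟩ := hsurf.exists_isChart hx
  obtain ⟨y, hy, rfl⟩ : x ∈ φ '' s := h.image_eq ▸ ⟨hxW, hx⟩
  obtain ⟨r, hr, hrs⟩ := Metric.nhds_basis_closedBall.mem_iff.1 (h.isOpen_source.mem_nhds hy)
  have hJc : ContinuousOn (fun y => ‖normalVec φ y‖) s := fun y hy =>
    (h.contDiffAt_normalVec hy).continuousAt.norm.continuousWithinAt
  have hb := Metric.ball_subset_closedBall.trans hrs
  obtain ⟨W', hW'o, hW'⟩ := h.openMap _ hb Metric.isOpen_ball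
  refine ⟨φ '' Metric.ball y r, ?_, ?_⟩
  · refine mem_nhdsWithin.2 ⟨W', hW'o, ?_, hW'.symm.subset⟩
    exact (hW' ▸ mem_image_of_mem φ (Metric.mem_ball_self hr) : φ y ∈ W' ∩ M).1
  · have := euclideanHausdorffMeasure_image_eq_lintegral h.isOpen_source.measurableSet
      (fun y hy => h.hasStrictFDerivAt hy) h.immersion h.injOn hJc
      (fun y _ => norm_normalVec_eq φ y) Metric.isOpen_ball.measurableSet hb
    rw [show Module.finrank ℝ E2 = 2 by simp] at this
    rw [this]
    have hint : IntegrableOn (fun y => ‖normalVec φ y‖) (Metric.ball y r) :=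
      ((hJc.mono hrs).integrableOn_compact (isCompact_closedBall y r)).mono_set
        Metric.ball_subset_closedBall
    exact hint.lintegral_lt_top

/-- The divergence theorem on a compact surface. -/
theorem IsTangentField.integral_surfDiv {M : Set E3} {V : E3 → E3} (hV : IsTangentField M V)
    (hsurf : IsSmoothSurface M) (hMc : IsCompact M)
    (hM : ∀ x ∈ M, ∃ n : E3, n ≠ 0 ∧ ∀ v ∈ tangentAt M x, inner ℝ n v = 0) :
    IntegrableOn (surfDiv M V) M (μHE[2] : Measure E3) ∧
      ∫ x in M, surfDiv M V x ∂(μHE[2] : Measure E3) = 0 := by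
  choose! W s φ hch hxW using fun x (hx : x ∈ M) => hsurf.exists_isChart hx
  obtain ⟨t, htM, htc⟩ := hMc.elim_nhds_subcover W
    (fun x hx => (hch x hx).isOpen_target.mem_nhds (hxW x hx))
  obtain ⟨f, hf⟩ := SmoothPartitionOfUnity.exists_isSubordinate (modelWithCornersSelf ℝ E3)
    hMc.isClosed (fun i : t => W i) (fun i => (hch i (htM i i.2)).isOpen_target)
    (by rwa [iUnion_subtype])
  have hfd : ∀ i, ContDiff ℝ ∞ (f i) := fun i => contMDiff_iff_contDiff.1 (f i).contMDiff
  have hfV : ∀ i, IsTangentField M fun x => f i x • V x := fun i =>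
    ⟨((hfd i).of_le (by simp)).contDiffOn.smul hV.contDiffOn,
      fun x hx => Submodule.smul_mem _ _ (hV.mem x hx)⟩
  have hloc : ∀ i, _ := fun i : t =>
    (hch i (htM i i.2)).integral_surfDiv hsurf hMc hM (hfV i) (isClosed_tsupport (f i)) (hf i)
      fun x _ hx => by rw [image_eq_zero_of_notMem_tsupport hx, zero_smul]
  have hsum : ∀ x ∈ M, surfDiv M V x = ∑ i, surfDiv M (fun x => f i x • V x) x := by
    intro x hx
    obtain ⟨n, e₁, e₂, hfr⟩ := hsurf.exists_isTangentFrame hM hx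
    have hd : ∀ i, HasFDerivWithinAt (fun x => f i x • V x)
        (fderivWithin ℝ (fun x => f i x • V x) M x) M x := fun i =>
      (((hfV i).contDiffOn x hx).differentiableWithinAt one_ne_zero).hasFDerivWithinAt
    -- The partition sums to one only on `M`, which suffices for derivatives within `M`.
    have hone : ∀ z ∈ M, V z = ∑ i, f i z • V z := fun z hz => by
      rw [← Finset.sum_smul, ← finsum_eq_sum_of_fintype, f.sum_eq_one hz, one_smul]
    have hs : HasFDerivWithinAt V (∑ i, fderivWithin ℝ (fun x => f i x • V x) M x) M x :=
      (HasFDerivWithinAt.fun_sum fun i _ => hd i).congr hone (hone x hx)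
    rw [hfr.surfDiv_eq V _ hs]
    simp only [sum_apply, inner_sum, ← Finset.sum_add_distrib]
    exact Finset.sum_congr rfl fun i _ => (hfr.surfDiv_eq _ _ (hd i)).symm
  constructor
  · exact IntegrableOn.congr_fun (integrable_finsetSum _ fun i _ => (hloc i).1)
      (fun x hx => (hsum x hx).symm) hMc.measurableSet
  · rw [setIntegral_congr_fun hMc.measurableSet hsum,
      integral_finsetSum _ fun i _ => (hloc i).1]
    exact Finset.sum_eq_zero fun i _ => (hloc i).2

end Divergence

end Chart

/-! ### Differentiation in time under the integral -/

section TimeDependent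

theorem uniqueDiffOn_of_ordConnected {I : Set ℝ} (hI : I.OrdConnected) {s t : ℝ} (hs : s ∈ I)
    (ht : t ∈ I) (hst : s < t) : UniqueDiffOn ℝ I :=
  uniqueDiffOn_convex hI.convex ((nonempty_Ioo.2 hst).mono
    (interior_maximal (Ioo_subset_Icc_self.trans (hI.out hs ht)) isOpen_Ioo))

/-- `I ×ˢ M` need not have unique derivatives, so continuity of `fderivWithin` is unavailable. The
`C¹` hypothesis supplies locally some continuous derivative, and its value on `(1, 0)` is forced to
be the time derivative by uniqueness in `I`. -/
theorem continuousOn_derivWithin_of_contDiffOn {E F : Type*} [NormedAddCommGroup E]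
    [NormedSpace ℝ E] [NormedAddCommGroup F] [NormedSpace ℝ F] {I : Set ℝ} (hI : UniqueDiffOn ℝ I)
    {M : Set E} {u : ℝ → E → F} (hu : ContDiffOn ℝ 1 (fun z : ℝ × E => u z.1 z.2) (I ×ˢ M)) :
    (∀ t ∈ I, ∀ x ∈ M,
      HasDerivWithinAt (fun s => u s x) (derivWithin (fun s => u s x) I t) I t) ∧
    ContinuousOn (fun z : ℝ × E => derivWithin (fun s => u s z.2) I z.1) (I ×ˢ M) := by
  have hslice : ∀ (L : ℝ × E →L[ℝ] F), ∀ z ∈ I ×ˢ M,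
      HasFDerivWithinAt (fun z : ℝ × E => u z.1 z.2) L (I ×ˢ M) z →
      HasDerivWithinAt (fun s => u s z.2) (L (1, 0)) I z.1 := by
    rintro L ⟨t, x⟩ hz hL
    have h1 : HasDerivWithinAt (fun s : ℝ => (s, x)) ((1 : ℝ), (0 : E)) I t :=
      (hasDerivWithinAt_id t I).prodMk (hasDerivWithinAt_const t I x)
    have h2 : MapsTo (fun s : ℝ => (s, x)) I (I ×ˢ M) := fun s hs => ⟨hs, hz.2⟩
    exact HasFDerivWithinAt.comp_hasDerivWithinAt t hL h1 h2
  constructor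
  · intro t ht x hx
    have := hslice _ (t, x) ⟨ht, hx⟩
      ((hu _ ⟨ht, hx⟩).differentiableWithinAt one_ne_zero).hasFDerivWithinAt
    exact this.differentiableWithinAt.hasDerivWithinAt
  · intro z hz
    have h := hu z hz
    rw [← zero_add (1 : WithTop ℕ∞), contDiffWithinAt_succ_iff_hasFDerivWithinAt' (by simp)] at h
    obtain ⟨N, hN, hNs, -, f', hf', hc⟩ := h
    rw [insert_eq_of_mem hz] at hN hNs
    have hev : (fun z : ℝ × E => derivWithin (fun s => u s z.2) I z.1) =ᶠ[𝓝[I ×ˢ M] z]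
        fun z => f' z (1, 0) := by
      filter_upwards [hN] with y hy
      exact (hslice _ y (hNs hy) (hf' y hy)).derivWithin (hI _ (hNs hy).1)
    refine ContinuousWithinAt.congr_of_eventuallyEq ?_ hev (hev.self_of_nhdsWithin hz)
    exact hc.continuousWithinAt.clm_apply continuousWithinAt_const

/-- Compactness bounds `f` and `f'` by constants, which are integrable on `M`; dominated convergence
and the mean value theorem do the rest. -/
theorem setIntegral_eq_of_forall_setIntegral_deriv_eq_zero {X : Type*} [TopologicalSpace X]
    [MeasurableSpace X] [BorelSpace X] [T2Space X] [SecondCountableTopology X] {μ : Measure X}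
    {M : Set X} (hM : IsCompact M) (hμ : μ M < ⊤) {s t : ℝ} (hst : s < t) {f f' : ℝ → X → ℝ}
    (hf : ContinuousOn (fun z : ℝ × X => f z.1 z.2) (Icc s t ×ˢ M))
    (hf' : ContinuousOn (fun z : ℝ × X => f' z.1 z.2) (Icc s t ×ˢ M))
    (hd : ∀ τ ∈ Icc s t, ∀ x ∈ M, HasDerivWithinAt (fun r => f r x) (f' τ x) (Icc s t) τ)
    (h0 : ∀ τ ∈ Icc s t, ∫ x in M, f' τ x ∂μ = 0) :
    ∫ x in M, f s x ∂μ = ∫ x in M, f t x ∂μ := by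
  have hK : IsCompact (Icc s t ×ˢ M) := isCompact_Icc.prod hM
  obtain ⟨B, hB⟩ := hK.exists_bound_of_continuousOn hf
  obtain ⟨B', hB'⟩ := hK.exists_bound_of_continuousOn hf'
  have hslice : ∀ {g : ℝ → X → ℝ}, ContinuousOn (fun z : ℝ × X => g z.1 z.2) (Icc s t ×ˢ M) →
      ∀ τ ∈ Icc s t, AEStronglyMeasurable (g τ) (μ.restrict M) := fun hg τ hτ =>
    (hg.comp (f := fun x => (τ, x)) (by fun_prop) fun x hx => ⟨hτ, hx⟩).aestronglyMeasurable
      hM.measurableSet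
  have hconst : ∀ c : ℝ, Integrable (fun _ => c) (μ.restrict M) := fun c =>
    integrableOn_const hμ.ne
  have hcont : ContinuousOn (fun τ => ∫ x in M, f τ x ∂μ) (Icc s t) := by
    refine continuousOn_of_dominated (hslice hf) (bound := fun _ => B) (fun τ hτ => ?_) (hconst B) ?_
    · exact (ae_restrict_mem hM.measurableSet).mono fun x hx => hB (τ, x) ⟨hτ, hx⟩
    · exact (ae_restrict_mem hM.measurableSet).mono fun x hx τ hτ =>
        (hd τ hτ x hx).continuousWithinAt
  have hderiv : ∀ τ ∈ Ioo s t, HasDerivAt (fun τ => ∫ x in M, f τ x ∂μ) 0 τ := by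
    intro τ hτ
    have hτ' := Ioo_subset_Icc_self hτ
    rw [← h0 τ hτ']
    have hN : Ioo s t ∈ 𝓝 τ := isOpen_Ioo.mem_nhds hτ
    refine (hasDerivAt_integral_of_dominated_loc_of_deriv_le (bound := fun _ => B') hN
      (eventually_of_mem hN fun r hr => hslice hf r (Ioo_subset_Icc_self hr))
      ((hconst B).mono' (hslice hf τ hτ') ?_) (hslice hf' τ hτ') ?_ (hconst B') ?_).2
    · exact (ae_restrict_mem hM.measurableSet).mono fun x hx => hB (τ, x) ⟨hτ', hx⟩
    · exact (ae_restrict_mem hM.measurableSet).mono fun x hx r hr =>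
        hB' (r, x) ⟨Ioo_subset_Icc_self hr, hx⟩
    · exact (ae_restrict_mem hM.measurableSet).mono fun x hx r hr =>
        (hd r (Ioo_subset_Icc_self hr) x hx).hasDerivAt (Icc_mem_nhds hr.1 hr.2)
  obtain ⟨c, -, hc⟩ := exists_hasDerivAt_eq_slope _ _ hst hcont hderiv
  rw [eq_div_iff (sub_pos.2 hst).ne', zero_mul] at hc
  linarith

end TimeDependent

/-! ### Pointwise identities for the gradient, divergence and Coriolis term -/

section Pointwise

variable {M : Set E3} {x n e₁ e₂ : E3}

theorem inner_surfGrad {f : E3 → ℝ} {L : E3 →L[ℝ] ℝ} (hf : HasFDerivWithinAt f L M x) {v : E3}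
    (hv : v ∈ tangentAt M x) : inner ℝ (surfGrad M f x) v = L v := by
  rw [surfGrad, Submodule.inner_starProjection_left_eq_right,
    Submodule.starProjection_eq_self_iff.2 hv, gradientWithin,
    InnerProductSpace.toDual_symm_apply, fderivWithin_apply_of_mem_tangentAt hf hv]

theorem IsTangentFrame.surfDiv_smul (h : IsTangentFrame M x n e₁ e₂) {f : E3 → ℝ}
    {L : E3 →L[ℝ] ℝ} {V : E3 → E3} {A : E3 →L[ℝ] E3} (hf : HasFDerivWithinAt f L M x)
    (hV : HasFDerivWithinAt V A M x) (hVn : inner ℝ n (V x) = 0) :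
    surfDiv M (fun x => f x • V x) x = f x * surfDiv M V x + L (V x) := by
  rw [h.surfDiv_eq _ _ (hf.fun_smul hV), h.surfDiv_eq _ _ hV]
  conv_rhs => rw [h.expand_tangent hVn]
  simp [inner_add_right, inner_smul_right]
  ring

/-- In the product rule the terms differentiating `ν` are triple products of tangent vectors and
vanish. The rest is `∑ ⟨eᵢ, n × A eᵢ⟩ = ⟨A e₂, e₁⟩ - ⟨A e₁, e₂⟩`. -/
theorem IsTangentFrame.surfDiv_cross (h : IsTangentFrame M x n e₁ e₂) {ν u : E3 → E3}
    {A B : E3 →L[ℝ] E3} {w : ℝ} (hνx : ν x = n) (hν : HasFDerivWithinAt ν B M x)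
    (hu : HasFDerivWithinAt u A M x) (hun : inner ℝ n (u x) = 0)
    (hB : ∀ v ∈ tangentAt M x, inner ℝ n (B v) = 0)
    (hw : inner ℝ (A e₁) e₂ - inner ℝ (A e₂) e₁ = w) :
    surfDiv M (fun x => cross (ν x) (u x)) x = -w := by
  have hn : n ≠ 0 := by
    rintro rfl
    simpa using h.inner_normal
  have hd : HasFDerivWithinAt (fun x => cross (ν x) (u x)) _ M x :=
    crossL.hasFDerivWithinAt_of_bilinear hν hu
  rw [h.surfDiv_eq _ _ hd]
  simp only [add_apply, ContinuousLinearMap.precompR_apply, ContinuousLinearMap.precompL_apply,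
    ContinuousLinearMap.compL_apply, ContinuousLinearMap.comp_apply, crossL_apply, inner_add_right]
  rw [inner_cross_eq_zero_of_orthogonal hn (h.normal _ h.mem₁) (hB _ h.mem₁) hun,
    inner_cross_eq_zero_of_orthogonal hn (h.normal _ h.mem₂) (hB _ h.mem₂) hun, hνx,
    inner_cross_cyclic e₁, inner_cross_cyclic e₂, h.inner_normal_cross, h.inner_normal_cross, ← hw,
    h.inner₁₁, h.inner₂₂, h.inner₁₂, real_inner_comm e₁ e₂, h.inner₁₂, real_inner_comm e₂,
    real_inner_comm e₁]
  ring

/-- The generator of the rotations about the third axis, as a continuous linear map. -/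
def X3L : E3 →L[ℝ] E3 := crossL (EuclideanSpace.single 2 1)

theorem X3L_apply (x : E3) : X3L x = X3 x := by
  ext i; fin_cases i <;> simp [X3L, X3]

theorem inner_X3_self (v : E3) : inner ℝ (X3 v) v = 0 := by
  simp [inner_eq_sum, X3]; ring

theorem hasFDerivWithinAt_X3 : HasFDerivWithinAt X3 X3L M x := by
  have : X3 = X3L := funext fun x => (X3L_apply x).symm
  rw [this]
  exact X3L.hasFDerivWithinAt

/-- Half of the squared distance to the third axis. -/
def halfSqRadius (x : E3) : ℝ := (x 0 ^ 2 + x 1 ^ 2) / 2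

theorem contDiff_halfSqRadius : ContDiff ℝ ∞ halfSqRadius := by
  unfold halfSqRadius; fun_prop

theorem hasFDerivAt_halfSqRadius (x : E3) :
    HasFDerivAt halfSqRadius (x 0 • EuclideanSpace.proj 0 + x 1 • EuclideanSpace.proj 1 :
      E3 →L[ℝ] ℝ) x := by
  have h : ∀ i : Fin 3, HasFDerivAt (fun x : E3 => x i) (EuclideanSpace.proj i : E3 →L[ℝ] ℝ) x :=
    fun i => (EuclideanSpace.proj i : E3 →L[ℝ] ℝ).hasFDerivAt
  have := (((h 0).pow 2).add ((h 1).pow 2)).mul_const (2⁻¹ : ℝ)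
  refine (this.congr_fderiv ?_).congr_of_eventuallyEq (.of_forall fun y => ?_)
  · ext v; simp; ring
  · simp [halfSqRadius, div_eq_mul_inv]

/-- The Coriolis term paired with the generator of rotations is the derivative of half of the
squared distance to the axis. -/
theorem chi_mul_inner_X3_rotJ {ν : E3 → E3} {v : E3} (hn : ‖ν x‖ = 1)
    (hX : inner ℝ (ν x) (X3 x) = 0) (hv : inner ℝ (ν x) v = 0) :
    chi ν x * inner ℝ (X3 x) (rotJ ν x v) = x 0 * v 0 + x 1 * v 1 := by
  have h1 : inner ℝ (ν x) (ν x) = 1 := by rw [real_inner_self_eq_norm_sq, hn, one_pow]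
  simp only [inner_eq_sum, X3, chi, rotJ, cross_apply_zero, cross_apply_one, cross_apply_two] at *
  simp at *
  -- Geometrically, `hX` makes the horizontal part of `ν` radial off the axis: `ν = a r̂ + χ e₃`.
  -- Then `⟨X₃, Jv⟩ = r (χ v_r - a v₃)`, and `a v_r + χ v₃ = 0` with `a² + χ² = 1` gives `χ ⟨X₃, Jv⟩
  -- = r v_r`.
  linear_combination (x 0 * v 0 + x 1 * v 1) * h1 - (ν x 0 * x 0 + ν x 1 * x 1) * hv +
    (ν x 0 * v 1 - ν x 1 * v 0) * hX

end Pointwise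

theorem inner_convect {M : Set E3} {u : E3 → E3} {x v : E3} (hv : v ∈ tangentAt M x) :
    inner ℝ v (convect M u x) = inner ℝ v (fderivWithin ℝ u M x (u x)) := by
  rw [convect, ← Submodule.inner_starProjection_left_eq_right,
    Submodule.starProjection_eq_self_iff.2 hv]

/-! ### Vorticity and angular momentum densities -/

section Surface

variable {M : Set E3} {ν : E3 → E3}

/-- Data of a compact surface with a smooth unit normal field. -/
structure IsOrientedSurface (M : Set E3) (ν : E3 → E3) : Prop where
  isCompact : IsCompact M
  isSmoothSurface : IsSmoothSurface M
  contDiffOn : ContDiffOn ℝ ∞ ν M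
  norm_eq_one : ∀ x ∈ M, ‖ν x‖ = 1
  normal : ∀ x ∈ M, ∀ v ∈ tangentAt M x, inner ℝ (ν x) v = 0

namespace IsOrientedSurface

theorem tangentAt_eq (h : IsOrientedSurface M ν) {x : E3} (hx : x ∈ M) :
    tangentAt M x = (ℝ ∙ ν x)ᗮ :=
  tangentAt_eq_orthogonal h.isSmoothSurface hx
    (by rw [← norm_ne_zero_iff, h.norm_eq_one x hx]; exact one_ne_zero) (h.normal x hx)

theorem mem_tangentAt_iff (h : IsOrientedSurface M ν) {x : E3} (hx : x ∈ M) {v : E3} :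
    v ∈ tangentAt M x ↔ inner ℝ (ν x) v = 0 := by
  rw [h.tangentAt_eq hx, Submodule.mem_orthogonal_singleton_iff_inner_right]

theorem exists_frame (h : IsOrientedSurface M ν) {x : E3} (hx : x ∈ M) :
    ∃ e₁ e₂, IsTangentFrame M x (ν x) e₁ e₂ :=
  exists_isTangentFrame (h.norm_eq_one x hx) (h.tangentAt_eq hx)

theorem integral_surfDiv (h : IsOrientedSurface M ν) {V : E3 → E3} (hV : IsTangentField M V) :
    IntegrableOn (surfDiv M V) M (μHE[2] : Measure E3) ∧
      ∫ x in M, surfDiv M V x ∂(μHE[2] : Measure E3) = 0 :=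
  hV.integral_surfDiv h.isSmoothSurface h.isCompact fun x hx =>
    ⟨ν x, by rw [← norm_ne_zero_iff, h.norm_eq_one x hx]; exact one_ne_zero, h.normal x hx⟩

theorem integrableOn (h : IsOrientedSurface M ν) {f : E3 → ℝ} (hf : ContinuousOn f M) :
    IntegrableOn f M (μHE[2] : Measure E3) := by
  obtain ⟨B, hB⟩ := h.isCompact.exists_bound_of_continuousOn hf
  exact IntegrableOn.of_bound (h.isSmoothSurface.measure_lt_top_of_isCompact h.isCompact)
    (hf.aestronglyMeasurable h.isCompact.measurableSet) B
    ((ae_restrict_mem h.isCompact.measurableSet).mono hB)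

theorem isTangentField_cross (h : IsOrientedSurface M ν) {u : E3 → E3} (hu : ContDiffOn ℝ 1 u M) :
    IsTangentField M fun x => cross (ν x) (u x) :=
  ⟨(crossL.contDiff.comp_contDiffOn (h.contDiffOn.of_le (by simp))).clm_apply hu,
    fun _ hx => (h.mem_tangentAt_iff hx).2 (inner_cross_self_left _ _)⟩

theorem inner_fderivWithin_normal (h : IsOrientedSurface M ν) {x : E3} (hx : x ∈ M) {v : E3}
    (hv : v ∈ tangentAt M x) : inner ℝ (ν x) (fderivWithin ℝ ν M x v) = 0 := by
  have hB : HasFDerivWithinAt ν (fderivWithin ℝ ν M x) M x :=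
    ((h.contDiffOn x hx).differentiableWithinAt (by simp)).hasFDerivWithinAt
  have h1 : HasFDerivWithinAt (fun x => inner ℝ (ν x) (ν x)) _ M x := hB.inner ℝ hB
  have h2 : HasFDerivWithinAt (fun x => inner ℝ (ν x) (ν x)) (0 : E3 →L[ℝ] ℝ) M x := by
    have h3 : ∀ z ∈ M, inner ℝ (ν z) (ν z) = (1 : ℝ) := fun z hz => by
      rw [real_inner_self_eq_norm_sq, h.norm_eq_one z hz, one_pow]
    exact (hasFDerivWithinAt_const (1 : ℝ) x M).congr h3 (h3 x hx)
  have h4 := (fderivWithin_apply_of_mem_tangentAt h1 hv).symm.trans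
    (fderivWithin_apply_of_mem_tangentAt h2 hv)
  simp only [ContinuousLinearMap.comp_apply, ContinuousLinearMap.prod_apply, fderivInnerCLM_apply,
    zero_apply] at h4
  rw [real_inner_comm (ν x)] at h4
  linarith

/-- The product of a stream function of `-X` and the vorticity, up to a divergence. -/
theorem mul_vorticity_eq (h : IsOrientedSurface M ν) {ξ : E3 → ℝ} {X : E3 → E3}
    (hξ : ContDiffOn ℝ ∞ ξ M) (hξX : ∀ x ∈ M, rotJ ν x (surfGrad M ξ x) = -X x) {u : E3 → E3}
    {w : E3 → ℝ} (hu : IsTangentField M u) (hw : IsVorticity M ν u w) {x : E3} (hx : x ∈ M) :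
    ξ x * w x = inner ℝ (X x) (u x) - surfDiv M (fun x => ξ x • cross (ν x) (u x)) x := by
  obtain ⟨e₁, e₂, hfr⟩ := h.exists_frame hx
  have hξd : HasFDerivWithinAt ξ (fderivWithin ℝ ξ M x) M x :=
    ((hξ x hx).differentiableWithinAt (by simp)).hasFDerivWithinAt
  have hνd : HasFDerivWithinAt ν (fderivWithin ℝ ν M x) M x :=
    ((h.contDiffOn x hx).differentiableWithinAt (by simp)).hasFDerivWithinAt
  have hud : HasFDerivWithinAt u (fderivWithin ℝ u M x) M x :=
    ((hu.contDiffOn x hx).differentiableWithinAt one_ne_zero).hasFDerivWithinAt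
  have hc := h.isTangentField_cross hu.contDiffOn
  have hcd := ((hc.contDiffOn x hx).differentiableWithinAt one_ne_zero).hasFDerivWithinAt
  have hwx := hw x hx e₁ hfr.mem₁ e₂ hfr.mem₂
  rw [hfr.inner_cross, mul_one] at hwx
  have hdiv := hfr.surfDiv_cross rfl hνd hud (h.normal x hx _ (hu.mem x hx))
    (fun v hv => h.inner_fderivWithin_normal hx hv) hwx
  -- `J` is skew: `⟨∇ξ, Ju⟩ = -⟨J∇ξ, u⟩ = ⟨X, u⟩`.
  have hgrad : fderivWithin ℝ ξ M x (cross (ν x) (u x)) = inner ℝ (X x) (u x) := by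
    rw [← inner_surfGrad hξd (hc.mem x hx), ← neg_neg (X x), ← hξX x hx, rotJ, inner_neg_left,
      real_inner_comm (u x), inner_cross_cyclic, inner_cross_cyclic, inner_cross_swap,
      inner_cross_cyclic (u x)]
  rw [hfr.surfDiv_smul hξd hcd (h.normal x hx _ (hc.mem x hx)), hdiv, hgrad]
  ring

/-- The time derivative of the angular momentum density is a divergence. -/
theorem inner_X3_momentum (h : IsOrientedSurface M ν) (hX : ∀ x ∈ M, X3 x ∈ tangentAt M x)
    {u : E3 → E3} {p : E3 → ℝ} {a : E3} {Ω : ℝ} (hu : IsTangentField M u)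
    (hp : ContDiffOn ℝ 1 p M) {x : E3} (hx : x ∈ M) (hdiv : surfDiv M u x = 0)
    (hmom : a + convect M u x = (Ω * chi ν x) • rotJ ν x (u x) - surfGrad M p x) :
    inner ℝ (X3 x) a =
      surfDiv M (fun x => (Ω * halfSqRadius x - inner ℝ (X3 x) (u x)) • u x) x -
        surfDiv M (fun x => p x • X3 x) x := by
  obtain ⟨e₁, e₂, hfr⟩ := h.exists_frame hx
  have hud : HasFDerivWithinAt u (fderivWithin ℝ u M x) M x :=
    ((hu.contDiffOn x hx).differentiableWithinAt one_ne_zero).hasFDerivWithinAt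
  have hpd : HasFDerivWithinAt p (fderivWithin ℝ p M x) M x :=
    ((hp x hx).differentiableWithinAt one_ne_zero).hasFDerivWithinAt
  have hg : HasFDerivWithinAt (fun x => Ω * halfSqRadius x - inner ℝ (X3 x) (u x)) _ M x :=
    ((hasFDerivAt_halfSqRadius x).hasFDerivWithinAt.const_mul Ω).fun_sub
      (hasFDerivWithinAt_X3.inner ℝ hud)
  have hun := h.normal x hx _ (hu.mem x hx)
  have hXn := h.normal x hx _ (hX x hx)
  -- The derivative of `X3` is a skew linear map, so its trace on the tangent plane is zero.
  have hX3div : surfDiv M X3 x = 0 := by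
    rw [hfr.surfDiv_eq _ _ hasFDerivWithinAt_X3, X3L_apply, X3L_apply, real_inner_comm,
      inner_X3_self, real_inner_comm, inner_X3_self, add_zero]
  have hcor := chi_mul_inner_X3_rotJ (h.norm_eq_one x hx) hXn hun
  have ha : a = (Ω * chi ν x) • rotJ ν x (u x) - surfGrad M p x - convect M u x := by
    rw [← hmom, add_sub_cancel_right]
  rw [hfr.surfDiv_smul hg hud hun, hfr.surfDiv_smul hpd hasFDerivWithinAt_X3 hXn, hdiv, hX3div, ha,
    inner_sub_right, inner_sub_right, inner_smul_right, inner_convect (hX x hx),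
    real_inner_comm (surfGrad M p x), inner_surfGrad hpd (hX x hx), mul_assoc, hcor]
  -- The Killing property enters here: differentiating `⟨X₃, u⟩` along `u` produces the extra term
  -- `⟨X3 u, u⟩`, which vanishes.
  simp [X3L_apply, inner_X3_self]
  ring

end IsOrientedSurface
end Surface

end SurfaceEuler

end

/-! ### Conservation of the integral -/

open SurfaceEuler
theorem proposition3p3p1
    (O M : Set E3) (ν : E3 → E3)
    -- `M` is a smooth surface, the boundary of a bounded open set, and diffeomorphic to `S²`
    (hO : IsOpen O) (hOb : Bornology.IsBounded O) (hM : M = frontier O)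
    (hsurf : IsSmoothSurface M) (hdiffeo : DiffeoToSphere M)
    (hν : IsOutwardUnitNormal O M ν)
    -- `M` is invariant under rotations about the `x₃`-axis
    (hrot : ∀ s : ℝ, ∀ x ∈ M, rotZ s x ∈ M)
    -- `M` has positive Gauss curvature
    (hcurv : ∀ x ∈ M, 0 < gaussCurvature M ν x)
    -- `ξ` is a smooth function on `M` with `J∇ξ = -X₃`
    (ξ : E3 → ℝ) (hξ : ContDiffOn ℝ ∞ ξ M)
    (hξX : ∀ x ∈ M, rotJ ν x (surfGrad M ξ x) = -X3 x)
    -- `u` solves the Euler equation on the time interval `I`, and `w = rot u`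
    (Ω : ℝ) (I : Set ℝ) (hI : I.OrdConnected)
    (u : ℝ → E3 → E3) (p : ℝ → E3 → ℝ) (hu : IsEulerSolution M ν Ω I u p)
    (w : ℝ → E3 → ℝ) (hw : ∀ t ∈ I, IsVorticity M ν (u t) (w t)) :
    (∀ t ∈ I, IntegrableOn (fun x => ξ x * w t x) M (μHE[2] : Measure E3)) ∧
    ∀ s ∈ I, ∀ t ∈ I,
      ∫ x in M, ξ x * w s x ∂(μHE[2] : Measure E3) =
        ∫ x in M, ξ x * w t x ∂(μHE[2] : Measure E3) := by
  have hMc : IsCompact M := by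
    rw [hM]
    exact Metric.isCompact_of_isClosed_isBounded isClosed_frontier
      (hOb.closure.subset frontier_subset_closure)
  have h : IsOrientedSurface M ν := ⟨hMc, hsurf, hν.contDiffOn, hν.norm_eq_one, hν.normal⟩
  -- `X₃ = -J∇ξ` is a cross product with `ν`, hence orthogonal to it.
  have hX : ∀ x ∈ M, X3 x ∈ tangentAt M x := fun x hx => by
    rw [h.mem_tangentAt_iff hx, ← neg_neg (X3 x), ← hξX x hx, rotJ, inner_neg_right,
      inner_cross_self_left, neg_zero]
  have hX3 : ContDiff ℝ ∞ X3 := by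
    rw [show X3 = X3L from funext fun x => (X3L_apply x).symm]
    exact X3L.contDiff
  have hut : ∀ t ∈ I, IsTangentField M (u t) := fun t ht =>
    ⟨hu.contDiffOn_u.comp (f := fun x => (t, x)) (by fun_prop) fun x hx => ⟨ht, hx⟩,
      hu.tangent t ht⟩
  have hinner : ∀ t ∈ I, ContDiffOn ℝ 1 (fun x => inner ℝ (X3 x) (u t x)) M := fun t ht =>
    (hX3.of_le (by simp)).contDiffOn.inner ℝ (hut t ht).contDiffOn
  have hdivξ : ∀ t ∈ I, _ := fun t (ht : t ∈ I) => h.integral_surfDiv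
    (V := fun x => ξ x • cross (ν x) (u t x))
    ⟨(hξ.of_le (by simp)).smul (h.isTangentField_cross (hut t ht).contDiffOn).contDiffOn,
      fun x hx => Submodule.smul_mem _ _
        ((h.isTangentField_cross (hut t ht).contDiffOn).mem x hx)⟩
  have hξw : ∀ t ∈ I, ∀ x ∈ M, ξ x * w t x = _ := fun t ht x hx =>
    h.mul_vorticity_eq hξ hξX (hut t ht) (hw t ht) hx
  have hint : ∀ t ∈ I, IntegrableOn (fun x => inner ℝ (X3 x) (u t x)) M (μHE[2] : Measure E3) :=
    fun t ht => h.integrableOn (hinner t ht).continuousOn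
  have hangular : ∀ t ∈ I, ∫ x in M, ξ x * w t x ∂(μHE[2] : Measure E3) =
      ∫ x in M, inner ℝ (X3 x) (u t x) ∂(μHE[2] : Measure E3) := fun t ht => by
    rw [setIntegral_congr_fun hMc.measurableSet (hξw t ht),
      integral_sub (hint t ht) (hdivξ t ht).1, (hdivξ t ht).2, sub_zero]
  refine ⟨fun t ht => IntegrableOn.congr_fun ((hint t ht).sub (hdivξ t ht).1)
    (fun x hx => (hξw t ht x hx).symm) hMc.measurableSet, ?_⟩
  -- Two distinct times make `I` nondegenerate, so that `derivWithin` in time is determined.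
  have hlt : ∀ s ∈ I, ∀ t ∈ I, s < t →
      ∫ x in M, inner ℝ (X3 x) (u s x) ∂(μHE[2] : Measure E3) =
        ∫ x in M, inner ℝ (X3 x) (u t x) ∂(μHE[2] : Measure E3) := by
    intro s hs t ht hst
    have hsub : Icc s t ⊆ I := hI.out hs ht
    obtain ⟨hd, hc⟩ := continuousOn_derivWithin_of_contDiffOn
      (uniqueDiffOn_of_ordConnected hI hs ht hst) hu.contDiffOn_u
    have hXc : ContinuousOn (fun z : ℝ × E3 => X3 z.2) (Icc s t ×ˢ M) :=
      (hX3.continuous.comp continuous_snd).continuousOn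
    refine setIntegral_eq_of_forall_setIntegral_deriv_eq_zero hMc
      (hsurf.measure_lt_top_of_isCompact hMc) hst
      (f := fun τ x => inner ℝ (X3 x) (u τ x))
      (f' := fun τ x => inner ℝ (X3 x) (derivWithin (fun r => u r x) I τ))
      (hXc.inner (hu.contDiffOn_u.continuousOn.mono (prod_mono_left hsub)))
      (hXc.inner (hc.mono (prod_mono_left hsub))) (fun τ hτ x hx => ?_) fun τ hτ => ?_
    · have := (hasDerivWithinAt_const τ (Icc s t) (X3 x)).inner ℝ
        ((hd τ (hsub hτ) x hx).mono hsub)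
      simpa using this
    · have hτ' := hsub hτ
      have hV₁ := h.integral_surfDiv
        (V := fun x => (Ω * halfSqRadius x - inner ℝ (X3 x) (u τ x)) • u τ x)
        ⟨((contDiffOn_const.mul (contDiff_halfSqRadius.of_le (by simp)).contDiffOn).sub
          (hinner τ hτ')).smul (hut τ hτ').contDiffOn,
          fun x hx => Submodule.smul_mem _ _ ((hut τ hτ').mem x hx)⟩
      have hV₂ := h.integral_surfDiv (V := fun x => p τ x • X3 x)
        ⟨(hu.contDiffOn_p τ hτ').smul (hX3.of_le (by simp)).contDiffOn,
          fun x hx => Submodule.smul_mem _ _ (hX x hx)⟩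
      rw [setIntegral_congr_fun hMc.measurableSet fun x hx =>
        h.inner_X3_momentum hX (hut τ hτ') (hu.contDiffOn_p τ hτ') hx
          (hu.incompressible τ hτ' x hx) (hu.momentum τ hτ' x hx),
        integral_sub hV₁.1 hV₂.1, hV₁.2, hV₂.2, sub_zero]
  intro s hs t ht
  rw [hangular s hs, hangular t ht]
  rcases lt_trichotomy s t with hst | rfl | hst
  · exact hlt s hs t ht hst
  · rfl
  · exact (hlt t ht s hs hst).symm
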